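/- An instance consists of $n\ge 0$ keys $k_1<k_2<\dots<k_n$ from a linearly ordered set $K$ of possible queries, a weight $\beta_b\ge 0$ (a real number) for each key $k_b$ ($1\le b\le n$), and a weight $\alpha_a\ge 0$ for each interval $(k_a,k_{a+1})$ ($0\le a\le n$), where $k_0=-\infty$ and $k_{n+1}=+\infty$; each of these intervals contains some element of $K$. A two-way-comparison search tree for the instance is a rooted binary tree in which every non-leaf node is a comparison $q=k_b$ or $q<k_b$ with some key $k_b$, one child for each outcome, and whose $2n+1$ leaves are associated one-to-one with the $n$ keys and the $n+1$ intervals, such that for every query $q\in K$ (key or not) the search for $q$ from the root ends at the leaf associated with $k_b$ if $q=k_b$, and at the leaf associated with $(k_a,k_{a+1})$ if $q$ is not a key and lies in that interval. The cost of the tree is the sum, over its leaves, of the depth of the leaf times the weight of the associated key or interval; a search tree for the instance is optimal if no search tree for the instance has smaller cost. **Corollary 1.** There is an algorithm that, given $n$ and the weights $\beta_1,\dots,\beta_n,\alpha_0,\dots,\alpha_n$ of an instance, computes in $O(n^4)$ time (for $n\ge1$; in constant time for $n=0$) an optimal two-way-comparison search tree for the instance (in linked form, keys and intervals being given by their indices)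 together with its cost. Here an algorithm is one fixed program, the same for all $n$ and all instances, for a random access machine that operates at unit cost on words, that is, natural numbers bounded by a fixed polynomial in $n$ (addition, truncated subtraction, multiplication, comparison, array access), and on real numbers (addition, subtraction, comparison, and storage in arrays addressed by words). -/

import Mathlib

noncomputable section

namespace TwoWay

/-! ### The problem -/

/-- An instance with `n` keys from a linearly ordered set `K` of possible queries.
Keys are indexed from `0`: `key b` is the `(b+1)`-st smallest key.  The interval with index
`a ∈ {0, …, n}` is bounded below by `key (a-1)` (by `-∞` if `a = 0`) and above by `key a`
(by `+∞` if `a = n`).  Every interval contains a possible query.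
`β b` is the weight of `key b`, and `α a` is the weight of the interval with index `a`. -/
structure Inst (K : Type*) [LinearOrder K] (n : ℕ) where
  key : Fin n → K
  key_strictMono : StrictMono key
  gap_nonempty : ∀ a : Fin (n + 1), ∃ q : K,
    (∀ b : Fin n, b.val + 1 = a.val → key b < q) ∧ (∀ b : Fin n, b.val = a.val → q < key b)
  β : Fin n → ℝ
  β_nonneg : ∀ b, 0 ≤ β b
  α : Fin (n + 1) → ℝ
  α_nonneg : ∀ a, 0 ≤ α a

/-- What a leaf can be associated with: a key or an interval between consecutive keys. -/
inductive Label (n : ℕ)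
  | key (b : Fin n)
  | gap (a : Fin (n + 1))

/-- The two comparison operators. -/
inductive Cmp
  | eq
  | lt

/-- Rooted binary trees with labelled leaves whose inner nodes are comparisons `q = k_b` or
`q < k_b`; the first subtree is for the positive outcome, the second for the negative one. -/
inductive Tree (n : ℕ)
  | leaf (l : Label n)
  | node (c : Cmp) (b : Fin n) (yes no : Tree n)

namespace Tree

/-- The labels of the leaves, with multiplicity. -/
def leaves {n : ℕ} : Tree n → List (Label n)
  | leaf l => [l]
  | node _ _ yes no => yes.leaves ++ no.leaves

end Tree

namespace Inst

variable {K : Type*} [LinearOrder K] {n : ℕ}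

/-- The set of queries that a label stands for. -/
def region (I : Inst K n) : Label n → Set K
  | .key b => {I.key b}
  | .gap a => {q | (∀ b : Fin n, b.val + 1 = a.val → I.key b < q) ∧
      (∀ b : Fin n, b.val = a.val → q < I.key b)}

/-- The label of the leaf at which the search for `q` ends. -/
def search (I : Inst K n) (q : K) : Tree n → Label n
  | .leaf l => l
  | .node .eq b yes no => if q = I.key b then I.search q yes else I.search q no
  | .node .lt b yes no => if q < I.key b then I.search q yes else I.search q no

/-- Two-way-comparison search trees for the instance: every key and every interval is
associated with exactly one leaf, and the search identifies every query correctly. -/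
def IsSearchTree (I : Inst K n) (T : Tree n) : Prop :=
  T.leaves.Nodup ∧ (∀ l : Label n, l ∈ T.leaves) ∧
    ∀ (l : Label n) (q : K), q ∈ I.region l → I.search q T = l

def weight (I : Inst K n) : Label n → ℝ
  | .key b => I.β b
  | .gap a => I.α a

/-- The weighted depth of the leaves when the root is at depth `d`. -/
def costFrom (I : Inst K n) (d : ℕ) : Tree n → ℝ
  | .leaf l => (d : ℝ) * I.weight l
  | .node _ _ yes no => I.costFrom (d + 1) yes + I.costFrom (d + 1) no

/-- The cost: the sum over the leaves of depth times weight. -/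
def cost (I : Inst K n) (T : Tree n) : ℝ := I.costFrom 0 T

def IsOptimal (I : Inst K n) (T : Tree n) : Prop :=
  I.IsSearchTree T ∧ ∀ T' : Tree n, I.IsSearchTree T' → I.cost T ≤ I.cost T'

end Inst

/-! ### The machine

A random access machine with words (natural numbers up to a bound `w`) and real numbers.
It has registers and arrays of both sorts; a program uses finitely many of them.  Arrays are
addressed by words.  On words it can add, subtract (truncated at `0`), multiply and compare; on
reals it can only add, subtract and compare.  Each elementary operation takes one step. -/

structure State where
  /-- word registers -/
  reg : ℕ → ℕ
  /-- word arrays: `arr A i` is the cell of index `i` of the array `A` -/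
  arr : ℕ → ℕ → ℕ
  /-- real registers -/
  rreg : ℕ → ℝ
  /-- real arrays -/
  rarr : ℕ → ℕ → ℝ

/-- Word expressions. -/
inductive NExp
  | lit (c : ℕ)
  | var (x : ℕ)
  | read (A : ℕ) (i : NExp)
  | add (e f : NExp)
  | sub (e f : NExp)
  | mul (e f : NExp)

namespace NExp

def val (s : State) : NExp → ℕ
  | lit c => c
  | var x => s.reg x
  | read A i => s.arr A (i.val s)
  | add e f => e.val s + f.val s
  | sub e f => e.val s - f.val s
  | mul e f => e.val s * f.val s

/-- No number above `w` arises in the evaluation (registers and array cells are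
controlled when they are written). -/
def Fits (w : ℕ) (s : State) : NExp → Prop
  | lit c => c ≤ w
  | var _ => True
  | read _ i => i.Fits w s
  | add e f => e.Fits w s ∧ f.Fits w s ∧ e.val s + f.val s ≤ w
  | sub e f => e.Fits w s ∧ f.Fits w s
  | mul e f => e.Fits w s ∧ f.Fits w s ∧ e.val s * f.val s ≤ w

/-- Number of steps of the evaluation. -/
def time : NExp → ℕ
  | lit _ => 1
  | var _ => 1
  | read _ i => i.time + 1
  | add e f => e.time + f.time + 1
  | sub e f => e.time + f.time + 1
  | mul e f => e.time + f.time + 1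

end NExp

/-- Real expressions. -/
inductive RExp
  | zero
  | var (x : ℕ)
  | read (A : ℕ) (i : NExp)
  | add (e f : RExp)
  | sub (e f : RExp)

namespace RExp

def val (s : State) : RExp → ℝ
  | zero => 0
  | var x => s.rreg x
  | read A i => s.rarr A (i.val s)
  | add e f => e.val s + f.val s
  | sub e f => e.val s - f.val s

def Fits (w : ℕ) (s : State) : RExp → Prop
  | zero => True
  | var _ => True
  | read _ i => i.Fits w s
  | add e f => e.Fits w s ∧ f.Fits w s
  | sub e f => e.Fits w s ∧ f.Fits w s

def time : RExp → ℕ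
  | zero => 1
  | var _ => 1
  | read _ i => i.time + 1
  | add e f => e.time + f.time + 1
  | sub e f => e.time + f.time + 1

end RExp

/-- Tests. -/
inductive Test
  | le (e f : NExp)
  | eq (e f : NExp)
  | rle (e f : RExp)
  | not (c : Test)
  | and (c d : Test)

namespace Test

def Holds (s : State) : Test → Prop
  | le e f => e.val s ≤ f.val s
  | eq e f => e.val s = f.val s
  | rle e f => e.val s ≤ f.val s
  | not c => ¬ c.Holds s
  | and c d => c.Holds s ∧ d.Holds s

def Fits (w : ℕ) (s : State) : Test → Prop
  | le e f => e.Fits w s ∧ f.Fits w s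
  | eq e f => e.Fits w s ∧ f.Fits w s
  | rle e f => e.Fits w s ∧ f.Fits w s
  | not c => c.Fits w s
  | and c d => c.Fits w s ∧ d.Fits w s

def time : Test → ℕ
  | le e f => e.time + f.time + 1
  | eq e f => e.time + f.time + 1
  | rle e f => e.time + f.time + 1
  | not c => c.time + 1
  | and c d => c.time + d.time + 1

end Test

/-- Programs. -/
inductive Prog
  | skip
  | assign (x : ℕ) (e : NExp)
  | store (A : ℕ) (i e : NExp)
  | rassign (x : ℕ) (e : RExp)
  | rstore (A : ℕ) (i : NExp) (e : RExp)
  | seq (P Q : Prog)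
  | ite (c : Test) (P Q : Prog)
  | loop (c : Test) (P : Prog)

namespace State

def setReg (s : State) (x v : ℕ) : State :=
  { s with reg := Function.update s.reg x v }

def setArr (s : State) (A i v : ℕ) : State :=
  { s with arr := Function.update s.arr A (Function.update (s.arr A) i v) }

def setRreg (s : State) (x : ℕ) (v : ℝ) : State :=
  { s with rreg := Function.update s.rreg x v }

def setRarr (s : State) (A i : ℕ) (v : ℝ) : State :=
  { s with rarr := Function.update s.rarr A (Function.update (s.rarr A) i v) }

end State

/-- `Exec w P s t s'`: with words bounded by `w`, the program `P` started in the state `s`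
halts after `t` steps in the state `s'`.  A program that produces a number above `w` is stuck. -/
inductive Exec (w : ℕ) : Prog → State → ℕ → State → Prop
  | skip (s : State) : Exec w .skip s 1 s
  | assign (s : State) (x : ℕ) (e : NExp) (he : e.Fits w s) :
      Exec w (.assign x e) s (e.time + 1) (s.setReg x (e.val s))
  | store (s : State) (A : ℕ) (i e : NExp) (hi : i.Fits w s) (he : e.Fits w s) :
      Exec w (.store A i e) s (i.time + e.time + 1) (s.setArr A (i.val s) (e.val s))
  | rassign (s : State) (x : ℕ) (e : RExp) (he : e.Fits w s) :
      Exec w (.rassign x e) s (e.time + 1) (s.setRreg x (e.val s))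
  | rstore (s : State) (A : ℕ) (i : NExp) (e : RExp) (hi : i.Fits w s) (he : e.Fits w s) :
      Exec w (.rstore A i e) s (i.time + e.time + 1) (s.setRarr A (i.val s) (e.val s))
  | seq (P Q : Prog) (s s₁ s₂ : State) (t₁ t₂ : ℕ)
      (hP : Exec w P s t₁ s₁) (hQ : Exec w Q s₁ t₂ s₂) :
      Exec w (.seq P Q) s (t₁ + t₂) s₂
  | ite_pos (c : Test) (P Q : Prog) (s s₁ : State) (t : ℕ)
      (hc : c.Fits w s) (h : c.Holds s) (hP : Exec w P s t s₁) :
      Exec w (.ite c P Q) s (c.time + t) s₁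
  | ite_neg (c : Test) (P Q : Prog) (s s₁ : State) (t : ℕ)
      (hc : c.Fits w s) (h : ¬ c.Holds s) (hQ : Exec w Q s t s₁) :
      Exec w (.ite c P Q) s (c.time + t) s₁
  | loop_done (c : Test) (P : Prog) (s : State)
      (hc : c.Fits w s) (h : ¬ c.Holds s) :
      Exec w (.loop c P) s c.time s
  | loop_step (c : Test) (P : Prog) (s s₁ s₂ : State) (t₁ t₂ : ℕ)
      (hc : c.Fits w s) (h : c.Holds s) (hP : Exec w P s t₁ s₁)
      (hL : Exec w (.loop c P) s₁ t₂ s₂) :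
      Exec w (.loop c P) s (c.time + t₁ + t₂) s₂

/-- The machine is deterministic. -/
theorem Exec.det {w : ℕ} {P : Prog} {s s₁ s₂ : State} {t t' : ℕ}
    (h : Exec w P s t s₁) (h' : Exec w P s t' s₂) :
    t = t' ∧ s₁ = s₂ := by
  induction h generalizing t' s₂ with
  | seq P Q s a b t₁ t₂ hP hQ ih1 ih2 =>
    cases h' with | seq _ _ _ _ _ _ _ h1 h2 =>
    obtain ⟨rfl, rfl⟩ := ih1 h1
    obtain ⟨rfl, rfl⟩ := ih2 h2
    simp
  | ite_pos c P Q s a t hc h hP ih =>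
    cases h' with
    | ite_pos _ _ _ _ _ _ _ _ h1 => obtain ⟨rfl, rfl⟩ := ih h1; simp
    | ite_neg _ _ _ _ _ _ _ h0 h1 => exact absurd h h0
  | ite_neg c P Q s a t hc h hP ih =>
    cases h' with
    | ite_neg _ _ _ _ _ _ _ _ h1 => obtain ⟨rfl, rfl⟩ := ih h1; simp
    | ite_pos _ _ _ _ _ _ _ h0 h1 => exact absurd h0 h
  | loop_done c P s hc h =>
    cases h' with
    | loop_done => simp
    | loop_step _ _ _ _ _ _ _ _ h0 => exact absurd h0 h
  | loop_step c P s a b t₁ t₂ hc h hP hL ih1 ih2 =>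
    cases h' with
    | loop_done _ _ _ _ h0 => exact absurd h h0
    | loop_step _ _ _ _ _ _ _ _ h0 h1 h2 =>
      obtain ⟨rfl, rfl⟩ := ih1 h1
      obtain ⟨rfl, rfl⟩ := ih2 h2
      simp
  | _ => cases h'; simp

/-! ### Input and output -/

/-- The initial state: `n` is in word register `0`, the weights of the keys are in the cells
`0, …, n-1` of real array `0`, those of the intervals in the cells `0, …, n` of real array `1`,
and everything else is `0`. -/
def Inst.input {K : Type*} [LinearOrder K] {n : ℕ} (I : Inst K n) : State where
  reg := fun x => if x = 0 then n else 0
  arr := fun _ _ => 0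
  rreg := fun _ => 0
  rarr := fun A i =>
    if A = 0 then (if h : i < n then I.β ⟨i, h⟩ else 0)
    else if A = 1 then (if h : i < n + 1 then I.α ⟨i, h⟩ else 0)
    else 0

/-- The word `p` points to a record for the root of `T` in a linked representation of `T`.
Word array `0` holds the type of a node (`0` key leaf, `1` interval leaf, `2` equality test,
`3` less-than test), array `1` the index of its key or interval, and arrays `2` and `3`
the pointers to the roots of its two subtrees. -/
def State.Represents {n : ℕ} (s : State) : ℕ → Tree n → Prop
  | p, .leaf (.key b) => s.arr 0 p = 0 ∧ s.arr 1 p = b.val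
  | p, .leaf (.gap a) => s.arr 0 p = 1 ∧ s.arr 1 p = a.val
  | p, .node .eq b yes no => s.arr 0 p = 2 ∧ s.arr 1 p = b.val ∧
      s.Represents (s.arr 2 p) yes ∧ s.Represents (s.arr 3 p) no
  | p, .node .lt b yes no => s.arr 0 p = 3 ∧ s.arr 1 p = b.val ∧
      s.Represents (s.arr 2 p) yes ∧ s.Represents (s.arr 3 p) no

end TwoWay

end

/-!
Call a key *heavy* in a set of labels if no key of the set has a larger weight. Rotations show that
some optimal tree for a set of labels that contains a heavy key `h` is the leaf of `h`, begins with
the test `q = k_h`, or begins with a test `q < k_b` both of whose subtrees weigh at least as much as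
`h`: a heavy leaf can be moved up past any lighter sibling. Hence, if the keys are added one by one
in the order of increasing weight, the sets of labels that arise are determined by a stage and by
the ends of a run of intervals, and an optimal tree for such a set is found among one tree with an
equality test at the root and at most `n` trees with a less-than test at the root. With the optimal
trees of all stages and runs tabulated, each of the `O(n³)` entries takes `O(n)` time.
-/

noncomputable section

namespace TwoWay

variable {K : Type*} [LinearOrder K] {n : ℕ}

/-! ### Trees for a set of labels -/

/-- The labels whose queries pass the comparison with the key `b`. -/
def Cmp.accepted : Cmp → Fin n → Set (Label n)
  | .eq, b => {.key b}
  | .lt, b => {l | match l with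
    | .key e => e < b
    | .gap a => a.val ≤ b.val}

@[simp] theorem Cmp.accepted_eq (b : Fin n) : Cmp.eq.accepted b = {.key b} := rfl

@[simp] theorem Cmp.key_mem_accepted_lt {b e : Fin n} :
    Label.key e ∈ Cmp.lt.accepted b ↔ e.val < b.val := Iff.rfl

@[simp] theorem Cmp.gap_mem_accepted_lt {b : Fin n} {a : Fin (n + 1)} :
    Label.gap a ∈ Cmp.lt.accepted b ↔ a.val ≤ b.val := Iff.rfl

theorem Cmp.accepted_lt_mono : Monotone (Cmp.lt.accepted : Fin n → Set (Label n)) := by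
  rintro b c hbc (e | a) hl
  · exact lt_of_lt_of_le hl hbc
  · exact le_trans (gap_mem_accepted_lt.1 hl) hbc

/-- The search trees for the labels of a set `S`, described by the way in which their comparisons
split up `S`; no instance is needed for this. -/
def Tree.Solves : Set (Label n) → Tree n → Prop
  | S, .leaf l => S = {l}
  | S, .node c b yes no => yes.Solves (S ∩ c.accepted b) ∧ no.Solves (S \ c.accepted b)

namespace Tree

variable {S : Set (Label n)} {T T' U : Tree n}

theorem solves_leaf_iff {l : Label n} : (leaf l).Solves S ↔ S = {l} := Iff.rfl

theorem Solves.mem_leaves_iff (h : T.Solves S) {l : Label n} : l ∈ T.leaves ↔ l ∈ S := by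
  induction T generalizing S with
  | leaf l' => rw [solves_leaf_iff.1 h]; simp [leaves]
  | node c b Y N ihY ihN =>
    rw [leaves, List.mem_append, ihY h.1, ihN h.2, ← Set.mem_union, Set.inter_union_sdiff]

theorem Solves.nodup_leaves (h : T.Solves S) : T.leaves.Nodup := by
  induction T generalizing S with
  | leaf l => exact List.nodup_singleton l
  | node c b Y N ihY ihN =>
    refine List.nodup_append'.2 ⟨ihY h.1, ihN h.2, fun l hY hN => ?_⟩
    exact (h.2.mem_leaves_iff.1 hN).2 (h.1.mem_leaves_iff.1 hY).2

theorem Solves.leaves_perm (h : T.Solves S) (h' : T'.Solves S) : T.leaves.Perm T'.leaves :=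
  (List.perm_ext_iff_of_nodup h.nodup_leaves h'.nodup_leaves).2 fun _ =>
    h.mem_leaves_iff.trans h'.mem_leaves_iff.symm

theorem Solves.nonempty (h : T.Solves S) : S.Nonempty := by
  induction T generalizing S with
  | leaf l => exact ⟨l, solves_leaf_iff.1 h ▸ rfl⟩
  | node c b Y N ihY _ => exact (ihY h.1).mono Set.inter_subset_left

theorem solves_singleton_iff {l : Label n} : T.Solves {l} ↔ T = leaf l := by
  constructor
  · intro h
    cases T with
    | leaf l' => rw [Set.singleton_injective (solves_leaf_iff.1 h)]
    | node c b Y N =>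
      obtain ⟨_, rfl, hacc⟩ := h.1.nonempty
      obtain ⟨_, rfl, hrej⟩ := h.2.nonempty
      exact absurd hacc hrej
  · rintro rfl
    rfl

theorem solves_eq_iff {e : Fin n} {Y N : Tree n} : (node .eq e Y N).Solves S ↔
    .key e ∈ S ∧ Y = leaf (.key e) ∧ N.Solves (S \ {.key e}) := by
  constructor
  · rintro ⟨hY, hN⟩
    obtain ⟨_, he, rfl⟩ := hY.nonempty
    rw [Cmp.accepted_eq, Set.inter_singleton_of_mem he, solves_singleton_iff] at hY
    exact ⟨he, hY, hN⟩
  · rintro ⟨he, rfl, hN⟩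
    exact ⟨Set.inter_singleton_of_mem he, hN⟩

end Tree

namespace Inst

variable (I : Inst K n)

theorem region_nonempty (l : Label n) : (I.region l).Nonempty := by
  cases l with
  | key b => exact Set.singleton_nonempty _
  | gap a => exact I.gap_nonempty a

variable {I}

theorem lt_key_of_mem_region_gap {a : Fin (n + 1)} {q : K} (hq : q ∈ I.region (.gap a))
    {b : Fin n} (hab : a.val ≤ b.val) : q < I.key b :=
  (hq.2 ⟨a, hab.trans_lt b.isLt⟩ rfl).trans_le (I.key_strictMono.monotone hab)

theorem key_lt_of_mem_region_gap {a : Fin (n + 1)} {q : K} (hq : q ∈ I.region (.gap a))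
    {b : Fin n} (hba : b.val < a.val) : I.key b < q := by
  have hb : b.val ≤ a.val - 1 := by omega
  exact (I.key_strictMono.monotone hb).trans_lt
    (hq.1 ⟨a.val - 1, by omega⟩ (Nat.sub_add_cancel (by omega)))

theorem lt_key_iff {l : Label n} {q : K} (hq : q ∈ I.region l) (b : Fin n) :
    q < I.key b ↔ l ∈ Cmp.lt.accepted b := by
  cases l with
  | key e =>
    obtain rfl : q = I.key e := hq
    exact I.key_strictMono.lt_iff_lt
  | gap a =>
    rw [Cmp.gap_mem_accepted_lt]
    refine ⟨fun h => ?_, lt_key_of_mem_region_gap hq⟩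
    by_contra! hba
    exact lt_asymm h (key_lt_of_mem_region_gap hq hba)

theorem eq_key_iff {l : Label n} {q : K} (hq : q ∈ I.region l) (b : Fin n) :
    q = I.key b ↔ l ∈ Cmp.eq.accepted b := by
  cases l with
  | key e =>
    obtain rfl : q = I.key e := hq
    simp [I.key_strictMono.injective.eq_iff]
  | gap a =>
    simp only [Cmp.accepted_eq, Set.mem_singleton_iff, reduceCtorEq, iff_false]
    rcases le_or_gt a.val b.val with hab | hba
    · exact (lt_key_of_mem_region_gap hq hab).ne
    · exact (key_lt_of_mem_region_gap hq hba).ne'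

open Classical in
theorem search_node {l : Label n} {q : K} (hq : q ∈ I.region l) (c : Cmp) (b : Fin n)
    (Y N : Tree n) : I.search q (.node c b Y N) =
      if l ∈ c.accepted b then I.search q Y else I.search q N := by
  cases c
  · simp only [search, eq_key_iff hq]
  · simp only [search, lt_key_iff hq]

theorem search_mem_leaves (q : K) (T : Tree n) : I.search q T ∈ T.leaves := by
  induction T with
  | leaf l => exact List.mem_singleton_self l
  | node c b Y N ihY ihN =>
    rw [Tree.leaves, List.mem_append]
    cases c <;> rw [search] <;> split_ifs <;> tauto

theorem search_eq_of_solves {S : Set (Label n)} {T : Tree n} (h : T.Solves S) {l : Label n}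
    (hl : l ∈ S) {q : K} (hq : q ∈ I.region l) : I.search q T = l := by
  induction T generalizing S with
  | leaf l' => rw [Tree.solves_leaf_iff.1 h] at hl; exact hl.symm
  | node c b Y N ihY ihN =>
    rw [search_node hq]
    split_ifs with hacc
    · exact ihY h.1 ⟨hl, hacc⟩
    · exact ihN h.2 ⟨hl, hacc⟩

theorem solves_of_search_eq {S : Set (Label n)} {T : Tree n} (hnodup : T.leaves.Nodup)
    (hmem : ∀ l, l ∈ T.leaves ↔ l ∈ S)
    (hsearch : ∀ l ∈ S, ∀ q ∈ I.region l, I.search q T = l) : T.Solves S := by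
  induction T generalizing S with
  | leaf l => exact Set.ext fun l' => by simpa [Tree.leaves] using (hmem l').symm
  | node c b Y N ihY ihN =>
    obtain ⟨hY, hN, hdisj⟩ := List.nodup_append'.1 hnodup
    simp only [Tree.leaves, List.mem_append] at hmem
    have search_yes : ∀ l ∈ S ∩ c.accepted b, ∀ q ∈ I.region l, I.search q Y = l :=
      fun l hl q hq => by simpa only [search_node hq, if_pos hl.2] using hsearch l hl.1 q hq
    have search_no : ∀ l ∈ S \ c.accepted b, ∀ q ∈ I.region l, I.search q N = l :=
      fun l hl q hq => by simpa only [search_node hq, if_neg hl.2] using hsearch l hl.1 q hq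
    have mem_yes : ∀ l ∈ S ∩ c.accepted b, l ∈ Y.leaves := fun l hl => by
      obtain ⟨q, hq⟩ := I.region_nonempty l
      exact search_yes l hl q hq ▸ search_mem_leaves q Y
    have mem_no : ∀ l ∈ S \ c.accepted b, l ∈ N.leaves := fun l hl => by
      obtain ⟨q, hq⟩ := I.region_nonempty l
      exact search_no l hl q hq ▸ search_mem_leaves q N
    refine ⟨ihY hY (fun l => ⟨fun hl => ?_, mem_yes l⟩) search_yes,
      ihN hN (fun l => ⟨fun hl => ?_, mem_no l⟩) search_no⟩
    · have hS := (hmem l).1 (.inl hl)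
      exact ⟨hS, by_contra fun hacc => hdisj hl (mem_no l ⟨hS, hacc⟩)⟩
    · have hS := (hmem l).1 (.inr hl)
      exact ⟨hS, fun hacc => hdisj (mem_yes l ⟨hS, hacc⟩) hl⟩

theorem isSearchTree_iff_solves {T : Tree n} : I.IsSearchTree T ↔ T.Solves Set.univ := by
  constructor
  · rintro ⟨hnodup, hmem, hsearch⟩
    exact solves_of_search_eq hnodup (fun l => iff_of_true (hmem l) trivial)
      fun l _ => hsearch l
  · intro h
    exact ⟨h.nodup_leaves, fun l => h.mem_leaves_iff.2 trivial,
      fun l q => search_eq_of_solves h trivial⟩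

/-! ### Weight and cost -/

variable (I)

/-- The weight of a tree: the sum of the weights of its leaves. -/
def wt : Tree n → ℝ
  | .leaf l => I.weight l
  | .node _ _ yes no => wt yes + wt no

theorem wt_nonneg (T : Tree n) : 0 ≤ I.wt T := by
  induction T with
  | leaf l => cases l; exacts [I.β_nonneg _, I.α_nonneg _]
  | node _ _ _ _ ihY ihN => exact add_nonneg ihY ihN

theorem wt_eq_sum (T : Tree n) : I.wt T = (T.leaves.map I.weight).sum := by
  induction T with
  | leaf l => simp [wt, Tree.leaves]
  | node c b Y N ihY ihN => simp [wt, Tree.leaves, ihY, ihN]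

theorem wt_eq_of_solves {S : Set (Label n)} {T T' : Tree n} (h : T.Solves S)
    (h' : T'.Solves S) : I.wt T = I.wt T' := by
  rw [I.wt_eq_sum, I.wt_eq_sum, ((h.leaves_perm h').map _).sum_eq]

theorem costFrom_eq (d : ℕ) (T : Tree n) : I.costFrom d T = d * I.wt T + I.cost T := by
  unfold cost
  induction T generalizing d with
  | leaf l => simp [costFrom, wt]
  | node c b Y N ihY ihN =>
    simp only [costFrom, wt]
    rw [ihY (d + 1), ihN (d + 1), ihY (0 + 1), ihN (0 + 1)]
    push_cast
    ring

@[simp] theorem cost_leaf (l : Label n) : I.cost (.leaf l) = 0 := by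
  simp [cost, costFrom]

theorem cost_node (c : Cmp) (b : Fin n) (Y N : Tree n) :
    I.cost (.node c b Y N) = I.wt Y + I.wt N + I.cost Y + I.cost N := by
  rw [cost, costFrom, I.costFrom_eq, I.costFrom_eq]
  push_cast
  ring

/-! ### Lifting a heavy key -/

/-- The shapes of the root to which a search tree can be brought when `h` is the heaviest key. -/
inductive HeavyRoot (h : Fin n) : Tree n → Prop
  | leaf : HeavyRoot h (.leaf (.key h))
  | eq (U : Tree n) : HeavyRoot h (.node .eq h (.leaf (.key h)) U)
  | lt (b : Fin n) (L R : Tree n) (hL : I.β h ≤ I.wt L) (hR : I.β h ≤ I.wt R) :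
      HeavyRoot h (.node .lt b L R)

variable {I} {S : Set (Label n)} {h : Fin n}

theorem HeavyRoot.le_wt {T : Tree n} (hT : I.HeavyRoot h T) : I.β h ≤ I.wt T := by
  cases hT with
  | leaf => exact le_rfl
  | eq U => exact le_add_of_nonneg_right (I.wt_nonneg U)
  | lt b L R hL _ => exact le_add_of_le_of_nonneg hL (I.wt_nonneg R)

theorem HeavyRoot.exists_of_eq {e : Fin n} {N : Tree n} (heh : e ≠ h) (hle : I.β e ≤ I.β h)
    (hN : I.HeavyRoot h N) (hS : (Tree.node .eq e (.leaf (.key e)) N).Solves S) :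
    ∃ T', T'.Solves S ∧ I.cost T' ≤ I.cost (.node .eq e (.leaf (.key e)) N) ∧
      I.HeavyRoot h T' := by
  obtain ⟨he, -, hNS⟩ := Tree.solves_eq_iff.1 hS
  have hkey : Label.key e ≠ .key h := by simpa using heh
  cases hN with
  | leaf =>
    have hh : Label.key h ∈ S := (hNS.mem_leaves_iff.1 (List.mem_singleton_self _)).1
    have hrest : S \ {.key h} = {.key e} := by
      rw [← Tree.solves_leaf_iff.1 hNS, Set.sdiff_sdiff_cancel_left (by simpa)]
    refine ⟨_, Tree.solves_eq_iff.2 ⟨hh, rfl, Tree.solves_leaf_iff.2 hrest⟩, ?_, .eq _⟩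
    simp only [cost_node, cost_leaf, wt, weight]
    linarith
  | eq U =>
    obtain ⟨hh, -, hU⟩ := Tree.solves_eq_iff.1 hNS
    refine ⟨.node .eq h (.leaf (.key h)) (.node .eq e (.leaf (.key e)) U),
      Tree.solves_eq_iff.2 ⟨hh.1, rfl, Tree.solves_eq_iff.2 ⟨⟨he, hkey⟩, rfl, ?_⟩⟩, ?_, .eq _⟩
    · rwa [Set.sdiff_sdiff_comm]
    · simp only [cost_node, cost_leaf, wt, weight]
      linarith
  | lt c L R hL hR =>
    by_cases hc : Label.key e ∈ Cmp.lt.accepted c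
    · refine ⟨.node .lt c (.node .eq e (.leaf (.key e)) L) R,
        ⟨Tree.solves_eq_iff.2 ⟨⟨he, hc⟩, rfl, ?_⟩, ?_⟩, ?_, .lt _ _ _ ?_ hR⟩
      · rw [Set.inter_sdiff_right_comm]; exact hNS.1
      · have := hNS.2
        rwa [Set.sdiff_sdiff_comm, Set.sdiff_singleton_eq_self fun h => h.2 hc] at this
      · simp only [cost_node, cost_leaf, wt, weight]
        linarith
      · exact le_add_of_nonneg_of_le (I.wt_nonneg _) hL
    · refine ⟨.node .lt c L (.node .eq e (.leaf (.key e)) R),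
        ⟨?_, Tree.solves_eq_iff.2 ⟨⟨he, hc⟩, rfl, ?_⟩⟩, ?_, .lt _ _ _ hL ?_⟩
      · have := hNS.1
        rwa [← Set.inter_sdiff_right_comm, Set.sdiff_singleton_eq_self fun h => hc h.2] at this
      · rw [Set.sdiff_sdiff_comm]; exact hNS.2
      · simp only [cost_node, cost_leaf, wt, weight]
        linarith
      · exact le_add_of_nonneg_of_le (I.wt_nonneg _) hR

theorem HeavyRoot.exists_of_lt_left {c : Fin n} {L R : Tree n} (hL : I.HeavyRoot h L)
    (hS : (Tree.node .lt c L R).Solves S) :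
    ∃ T', T'.Solves S ∧ I.cost T' ≤ I.cost (.node .lt c L R) ∧ I.HeavyRoot h T' := by
  rcases le_or_gt (I.β h) (I.wt R) with hR | hR
  · exact ⟨_, hS, le_rfl, .lt _ _ _ hL.le_wt hR⟩
  obtain ⟨hLS, hRS⟩ := hS
  cases hL with
  | leaf =>
    rw [Tree.solves_leaf_iff] at hLS
    have hh : Label.key h ∈ S ∩ Cmp.lt.accepted c := hLS ▸ rfl
    refine ⟨_, Tree.solves_eq_iff.2 ⟨hh.1, rfl, ?_⟩, ?_, .eq R⟩
    · rwa [← hLS, Set.sdiff_self_inter]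
    · simp only [cost_node, cost_leaf, le_refl]
  | eq U =>
    obtain ⟨hh, -, hU⟩ := Tree.solves_eq_iff.1 hLS
    refine ⟨.node .eq h (.leaf (.key h)) (.node .lt c U R),
      Tree.solves_eq_iff.2 ⟨hh.1, rfl, ?_, ?_⟩, ?_, .eq _⟩
    · rwa [← Set.inter_sdiff_right_comm]
    · rwa [Set.sdiff_sdiff_comm, Set.sdiff_singleton_eq_self fun h => h.2 hh.2]
    · simp only [cost_node, cost_leaf, wt, weight]
      linarith
  | lt d L₁ R₁ hL₁ hR₁ =>
    obtain ⟨hL₁S, hR₁S⟩ := hLS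
    have hdc : Cmp.lt.accepted d ⊆ Cmp.lt.accepted c := by
      obtain ⟨l, hl, hld⟩ := hR₁S.nonempty
      exact Cmp.accepted_lt_mono (le_of_not_ge fun hcd => hld (Cmp.accepted_lt_mono hcd hl.2))
    refine ⟨.node .lt d L₁ (.node .lt c R₁ R), ⟨?_, ?_, ?_⟩, ?_, .lt _ _ _ hL₁ ?_⟩
    · rwa [Set.inter_assoc, Set.inter_eq_right.2 hdc] at hL₁S
    · rwa [← Set.inter_sdiff_right_comm]
    · rwa [Set.sdiff_sdiff, Set.union_eq_right.2 hdc]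
    · simp only [cost_node, wt]
      linarith
    · exact le_add_of_le_of_nonneg hR₁ (I.wt_nonneg R)

theorem HeavyRoot.exists_of_lt_right {c : Fin n} {L R : Tree n} (hR : I.HeavyRoot h R)
    (hS : (Tree.node .lt c L R).Solves S) :
    ∃ T', T'.Solves S ∧ I.cost T' ≤ I.cost (.node .lt c L R) ∧ I.HeavyRoot h T' := by
  rcases le_or_gt (I.β h) (I.wt L) with hL | hL
  · exact ⟨_, hS, le_rfl, .lt _ _ _ hL hR.le_wt⟩
  obtain ⟨hLS, hRS⟩ := hS
  cases hR with
  | leaf =>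
    rw [Tree.solves_leaf_iff] at hRS
    have hh : Label.key h ∈ S \ Cmp.lt.accepted c := hRS ▸ rfl
    refine ⟨_, Tree.solves_eq_iff.2 ⟨hh.1, rfl, ?_⟩, ?_, .eq L⟩
    · rwa [← hRS, Set.sdiff_sdiff_right_self]
    · simp only [cost_node, cost_leaf, wt, weight]
      linarith
  | eq U =>
    obtain ⟨hh, -, hU⟩ := Tree.solves_eq_iff.1 hRS
    refine ⟨.node .eq h (.leaf (.key h)) (.node .lt c L U),
      Tree.solves_eq_iff.2 ⟨hh.1, rfl, ?_, ?_⟩, ?_, .eq _⟩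
    · rwa [← Set.inter_sdiff_right_comm, Set.sdiff_singleton_eq_self fun h => hh.2 h.2]
    · rwa [Set.sdiff_sdiff_comm]
    · simp only [cost_node, cost_leaf, wt, weight]
      linarith
  | lt d L₁ R₁ hL₁ hR₁ =>
    obtain ⟨hL₁S, hR₁S⟩ := hRS
    have hcd : Cmp.lt.accepted c ⊆ Cmp.lt.accepted d := by
      obtain ⟨l, hl, hld⟩ := hL₁S.nonempty
      exact Cmp.accepted_lt_mono (le_of_not_ge fun hdc => hl.2 (Cmp.accepted_lt_mono hdc hld))
    refine ⟨.node .lt d (.node .lt c L L₁) R₁, ⟨⟨?_, ?_⟩, ?_⟩, ?_, .lt _ _ _ ?_ hR₁⟩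
    · rwa [Set.inter_assoc, Set.inter_eq_right.2 hcd]
    · rwa [Set.inter_sdiff_right_comm]
    · rwa [Set.sdiff_sdiff, Set.union_eq_right.2 hcd] at hR₁S
    · simp only [cost_node, wt]
      linarith
    · exact le_add_of_nonneg_of_le (I.wt_nonneg L) hL₁

theorem exists_heavyRoot {T : Tree n} (hT : T.Solves S) (hh : .key h ∈ S)
    (heavy : ∀ f, .key f ∈ S → I.β f ≤ I.β h) :
    ∃ T', T'.Solves S ∧ I.cost T' ≤ I.cost T ∧ I.HeavyRoot h T' := by
  induction T generalizing S with
  | leaf l =>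
    obtain rfl : Label.key h = l := by rwa [Tree.solves_leaf_iff.1 hT] at hh
    exact ⟨_, hT, le_rfl, .leaf⟩
  | node c b Y N ihY ihN =>
    have ⟨hY, hN⟩ := hT
    by_cases hacc : Label.key h ∈ c.accepted b
    · cases c with
      | eq =>
        obtain rfl : h = b := by simpa using hacc
        obtain ⟨-, rfl, -⟩ := Tree.solves_eq_iff.1 hT
        exact ⟨_, hT, le_rfl, .eq N⟩
      | lt =>
        obtain ⟨Y', hY', hcost, hroot⟩ := ihY hY ⟨hh, hacc⟩ fun f hf => heavy f hf.1
        obtain ⟨T', hT', hcost', hroot'⟩ := hroot.exists_of_lt_left ⟨hY', hN⟩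
        refine ⟨T', hT', hcost'.trans ?_, hroot'⟩
        rw [cost_node, cost_node, I.wt_eq_of_solves hY' hY]
        gcongr
    · obtain ⟨N', hN', hcost, hroot⟩ := ihN hN ⟨hh, hacc⟩ fun f hf => heavy f hf.1
      have hle : I.cost (.node c b Y N') ≤ I.cost (.node c b Y N) := by
        rw [cost_node, cost_node, I.wt_eq_of_solves hN' hN]
        gcongr
      have hnode : (Tree.node c b Y N').Solves S := ⟨hY, hN'⟩
      suffices ∃ T', T'.Solves S ∧ I.cost T' ≤ I.cost (.node c b Y N') ∧ I.HeavyRoot h T' by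
        obtain ⟨T', hT', hcost', hroot'⟩ := this
        exact ⟨T', hT', hcost'.trans hle, hroot'⟩
      cases c with
      | eq =>
        obtain ⟨hb, rfl, -⟩ := Tree.solves_eq_iff.1 hnode
        exact hroot.exists_of_eq (by rintro rfl; exact hacc rfl) (heavy b hb) hnode
      | lt => exact hroot.exists_of_lt_right hnode

/-! ### Optimal trees for a set of labels -/

variable (I S)

/-- The trees of minimum cost among those that solve `S`. -/
structure OptimalFor (T : Tree n) : Prop where
  solves : T.Solves S
  le : ∀ T' : Tree n, T'.Solves S → I.cost T ≤ I.cost T'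

/-- The trees that solve `S` at a cost that can be undercut only by trees that begin with a
less-than test with a key of index `k` or more: the state of the search for an optimal tree after
the less-than tests with the keys of index below `k` have been tried at the root. -/
structure OptimalUpToSplits (k : ℕ) (T : Tree n) : Prop where
  solves : T.Solves S
  le : ∀ T' : Tree n, T'.Solves S → I.cost T ≤ I.cost T' ∨ ∃ (b : Fin n) (L R : Tree n),
    k ≤ b.val ∧ (Tree.node .lt b L R).Solves S ∧ I.cost (.node .lt b L R) ≤ I.cost T'

variable {I S} {T X : Tree n} {k : ℕ}

theorem optimalFor_univ_iff : I.OptimalFor Set.univ T ↔ I.IsOptimal T := by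
  simp only [IsOptimal, isSearchTree_iff_solves]
  exact ⟨fun h => ⟨h.solves, h.le⟩, fun h => ⟨h.1, h.2⟩⟩

theorem optimalFor_singleton (l : Label n) : I.OptimalFor {l} (.leaf l) :=
  ⟨rfl, fun T' hT' => by rw [Tree.solves_singleton_iff.1 hT']⟩

theorem OptimalFor.cost_node_le {c : Cmp} {b : Fin n} {Y N Y' N' : Tree n}
    (hY : I.OptimalFor (S ∩ c.accepted b) Y) (hN : I.OptimalFor (S \ c.accepted b) N)
    (h' : (Tree.node c b Y' N').Solves S) :
    I.cost (.node c b Y N) ≤ I.cost (.node c b Y' N') := by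
  rw [cost_node, cost_node, I.wt_eq_of_solves hY.solves h'.1, I.wt_eq_of_solves hN.solves h'.2]
  gcongr
  exacts [hY.le _ h'.1, hN.le _ h'.2]

theorem OptimalFor.optimalUpToSplits (hT : I.OptimalFor S T) (k : ℕ) :
    I.OptimalUpToSplits S k T :=
  ⟨hT.solves, fun T' hT' => .inl (hT.le T' hT')⟩

theorem OptimalUpToSplits.of_no_keys (hT : T.Solves S) (hkey : ∀ e, Label.key e ∉ S)
    (hS : ∀ l, S ≠ {l}) : I.OptimalUpToSplits S 0 T := by
  refine ⟨hT, fun T' hT' => .inr ?_⟩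
  cases T' with
  | leaf l => exact absurd hT' (hS l)
  | node c b Y N =>
    cases c with
    | eq => exact absurd (Tree.solves_eq_iff.1 hT').1 (hkey b)
    | lt => exact ⟨b, Y, N, Nat.zero_le _, hT', le_rfl⟩

theorem OptimalUpToSplits.of_heavy {U : Tree n} (hh : .key h ∈ S)
    (heavy : ∀ f, .key f ∈ S → I.β f ≤ I.β h) (hU : I.OptimalFor (S \ {.key h}) U) :
    I.OptimalUpToSplits S 0 (.node .eq h (.leaf (.key h)) U) := by
  refine ⟨Tree.solves_eq_iff.2 ⟨hh, rfl, hU.solves⟩, fun T' hT' => ?_⟩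
  obtain ⟨T'', hT'', hcost, hroot⟩ := exists_heavyRoot hT' hh heavy
  cases hroot with
  | leaf =>
    have hS : S \ {.key h} = ∅ := Set.sdiff_eq_empty.2 (Tree.solves_leaf_iff.1 hT'').subset
    exact absurd hU.solves.nonempty (Set.not_nonempty_iff_eq_empty.2 hS)
  | eq U' =>
    have hleaf : I.OptimalFor (S ∩ Cmp.eq.accepted h) (.leaf (.key h)) := by
      rw [Cmp.accepted_eq, Set.inter_singleton_of_mem hh]
      exact optimalFor_singleton _
    exact .inl ((hleaf.cost_node_le hU hT'').trans hcost)
  | lt b L R _ _ => exact .inr ⟨b, L, R, Nat.zero_le _, hT'', hcost⟩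

theorem OptimalUpToSplits.mono {k' : ℕ} (hT : I.OptimalUpToSplits S k T)
    (hk : ∀ (b : Fin n) (L R : Tree n), (Tree.node .lt b L R).Solves S → k' ≤ b.val) :
    I.OptimalUpToSplits S k' T :=
  ⟨hT.solves, fun T' hT' => (hT.le T' hT').imp_right fun ⟨b, L, R, _, hs, hle⟩ =>
    ⟨b, L, R, hk b L R hs, hs, hle⟩⟩

theorem OptimalUpToSplits.optimalFor (hT : I.OptimalUpToSplits S k T)
    (hk : ∀ (b : Fin n) (L R : Tree n), (Tree.node .lt b L R).Solves S → b.val < k) :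
    I.OptimalFor S T :=
  ⟨hT.solves, fun T' hT' => (hT.le T' hT').resolve_right fun ⟨b, L, R, hkb, hs, _⟩ =>
    hkb.not_gt (hk b L R hs)⟩

theorem OptimalUpToSplits.succ {b : Fin n} {L R : Tree n} (hT : I.OptimalUpToSplits S b T)
    (hL : I.OptimalFor (S ∩ Cmp.lt.accepted b) L) (hR : I.OptimalFor (S \ Cmp.lt.accepted b) R)
    (hX : X.Solves S) (hXT : I.cost X ≤ I.cost T) (hXb : I.cost X ≤ I.cost (.node .lt b L R)) :
    I.OptimalUpToSplits S (b + 1) X := by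
  refine ⟨hX, fun T' hT' => ?_⟩
  rcases hT.le T' hT' with hle | ⟨d, L', R', hbd, hs, hle⟩
  · exact .inl (hXT.trans hle)
  rcases eq_or_lt_of_le (Fin.le_def.2 hbd) with rfl | hlt
  · exact .inl (hXb.trans ((hL.cost_node_le hR hs).trans hle))
  · exact .inr ⟨d, L', R', hlt, hs, hle⟩

end Inst

/-! ### The sets of labels that arise -/

section Labels

variable {A : Finset (Fin n)} {i j : ℕ}

/-- The intervals with the indices `i, …, j` together with the keys from `A` among them; the key at
the lower end of the first interval is included, as a test `q < k_b` sends `k_b` to the right. -/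
def labels (A : Finset (Fin n)) (i j : ℕ) : Set (Label n) :=
  {l | match l with
    | .key e => e ∈ A ∧ i ≤ e.val + 1 ∧ e.val < j
    | .gap a => i ≤ a.val ∧ a.val ≤ j}

@[simp] theorem key_mem_labels {e : Fin n} :
    .key e ∈ labels A i j ↔ e ∈ A ∧ i ≤ e.val + 1 ∧ e.val < j := Iff.rfl

@[simp] theorem gap_mem_labels {a : Fin (n + 1)} :
    .gap a ∈ labels A i j ↔ i ≤ a.val ∧ a.val ≤ j := Iff.rfl

theorem labels_univ : labels (Finset.univ : Finset (Fin n)) 0 n = Set.univ := by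
  ext (e | a)
  · simp
  · simp [Nat.le_of_lt_succ a.isLt]

theorem labels_empty_self (a : Fin (n + 1)) : labels ∅ a a = {Label.gap a} := by
  ext (e | a')
  · simp
  · simp [le_antisymm_iff, and_comm]

theorem labels_ne_singleton (hij : i < j) (hj : j ≤ n) (l : Label n) : labels A i j ≠ {l} := by
  intro h
  have hi : Label.gap ⟨i, by omega⟩ ∈ labels A i j := by simp [hij.le]
  have hj : Label.gap ⟨j, by omega⟩ ∈ labels A i j := by simp [hij.le]
  rw [h] at hi hj
  have := hi.trans hj.symm
  simp only [Label.gap.injEq, Fin.mk.injEq] at this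
  omega

theorem labels_insert_diff_key {e : Fin n} (he : e ∉ A) :
    labels (insert e A) i j \ {.key e} = labels A i j := by
  ext (f | a)
  · simp only [Set.mem_sdiff, key_mem_labels, Finset.mem_insert, Set.mem_singleton_iff,
      Label.key.injEq]
    grind
  · simp

theorem labels_insert_of_notMem {e : Fin n} (he : ¬ (i ≤ e.val + 1 ∧ e.val < j)) :
    labels (insert e A) i j = labels A i j := by
  ext (f | a)
  · simp only [key_mem_labels, Finset.mem_insert]
    grind
  · simp

theorem labels_inter_accepted {b : Fin n} (hb : b.val < j) :
    labels A i j ∩ Cmp.lt.accepted b = labels A i b := by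
  ext (e | a) <;> simp only [Set.mem_inter_iff, key_mem_labels, gap_mem_labels,
    Cmp.key_mem_accepted_lt, Cmp.gap_mem_accepted_lt] <;> grind

theorem labels_diff_accepted {b : Fin n} (hb : i ≤ b.val) :
    labels A i j \ Cmp.lt.accepted b = labels A (b + 1) j := by
  ext (e | a) <;> simp only [Set.mem_sdiff, key_mem_labels, gap_mem_labels,
    Cmp.key_mem_accepted_lt, Cmp.gap_mem_accepted_lt] <;> grind

theorem solves_lt_labels_iff {b : Fin n} {L R : Tree n} :
    (Tree.node .lt b L R).Solves (labels A i j) ↔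
      i ≤ b.val ∧ b.val < j ∧ L.Solves (labels A i b) ∧ R.Solves (labels A (b + 1) j) := by
  constructor
  · intro h
    have hib : i ≤ b.val := by
      obtain ⟨e | a, hl, hacc⟩ := h.1.nonempty <;>
        simp only [key_mem_labels, gap_mem_labels, Cmp.key_mem_accepted_lt,
          Cmp.gap_mem_accepted_lt] at hl hacc <;> omega
    have hbj : b.val < j := by
      obtain ⟨e | a, hl, hrej⟩ := h.2.nonempty <;>
        simp only [key_mem_labels, gap_mem_labels, Cmp.key_mem_accepted_lt,
          Cmp.gap_mem_accepted_lt] at hl hrej <;> omega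
    exact ⟨hib, hbj, labels_inter_accepted hbj ▸ h.1, labels_diff_accepted hib ▸ h.2⟩
  · rintro ⟨hib, hbj, hL, hR⟩
    exact ⟨(labels_inter_accepted hbj).symm ▸ hL, (labels_diff_accepted hib).symm ▸ hR⟩

theorem Inst.OptimalFor.optimalUpToSplits_insert {I : Inst K n} {h : Fin n} {T : Tree n}
    (hT : I.OptimalFor (labels A i j) T) (hh : h ∉ A) (heavy : ∀ f ∈ A, I.β f ≤ I.β h)
    (hmem : i ≤ h.val + 1 ∧ h.val < j) :
    I.OptimalUpToSplits (labels (insert h A) i j) i (.node .eq h (.leaf (.key h)) T) := by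
  have hmax : ∀ f, .key f ∈ labels (insert h A) i j → I.β f ≤ I.β h := fun f hf =>
    (Finset.mem_insert.1 hf.1).elim (fun hfh => hfh ▸ le_rfl) (heavy f)
  have hopt := OptimalUpToSplits.of_heavy (by simpa using hmem) hmax
    ((labels_insert_diff_key hh).symm ▸ hT)
  exact hopt.mono fun b L R hsolves => (solves_lt_labels_iff.1 hsolves).1

end Labels

/-! ### Reasoning about programs -/

infixr:70 " ;; " => Prog.seq

attribute [simp] NExp.val NExp.Fits NExp.time RExp.val RExp.Fits RExp.time
  Test.Holds Test.Fits Test.time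

namespace State

variable (s : State) (x y A B i k v : ℕ) (r : ℝ)

@[simp] theorem reg_setReg : (s.setReg x v).reg y = if y = x then v else s.reg y := by
  simp [setReg, Function.update_apply]

@[simp] theorem arr_setReg : (s.setReg x v).arr = s.arr := rfl

@[simp] theorem rarr_setReg : (s.setReg x v).rarr = s.rarr := rfl

@[simp] theorem rreg_setRreg : (s.setRreg x r).rreg y = if y = x then r else s.rreg y := by
  simp [setRreg, Function.update_apply]

@[simp] theorem reg_setRreg : (s.setRreg x r).reg = s.reg := rfl

@[simp] theorem arr_setArr :
    (s.setArr A i v).arr B k = if B = A ∧ k = i then v else s.arr B k := by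
  by_cases h : B = A
  · subst h; simp [setArr, Function.update_apply]
  · simp [setArr, h]

@[simp] theorem reg_setArr : (s.setArr A i v).reg = s.reg := rfl

@[simp] theorem rarr_setArr : (s.setArr A i v).rarr = s.rarr := rfl

@[simp] theorem rarr_setRarr :
    (s.setRarr A i r).rarr B k = if B = A ∧ k = i then r else s.rarr B k := by
  by_cases h : B = A
  · subst h; simp [setRarr, Function.update_apply]
  · simp [setRarr, h]

@[simp] theorem reg_setRarr : (s.setRarr A i r).reg = s.reg := rfl

@[simp] theorem arr_setRarr : (s.setRarr A i r).arr = s.arr := rfl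

end State

/-- The total-correctness triple: started in `s`, the program halts within `t` steps in a state
with the property `Q`. -/
def Runs (w : ℕ) (P : Prog) (s : State) (t : ℕ) (Q : State → Prop) : Prop :=
  ∃ t' s', Exec w P s t' s' ∧ t' ≤ t ∧ Q s'

namespace Prog

/-- The weakest precondition of a program without loops. -/
@[simp] def wp (w : ℕ) : Prog → (State → Prop) → State → Prop
  | skip, Q, s => Q s
  | assign x e, Q, s => e.Fits w s ∧ Q (s.setReg x (e.val s))
  | store A i e, Q, s => (i.Fits w s ∧ e.Fits w s) ∧ Q (s.setArr A (i.val s) (e.val s))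
  | rassign x e, Q, s => e.Fits w s ∧ Q (s.setRreg x (e.val s))
  | rstore A i e, Q, s => (i.Fits w s ∧ e.Fits w s) ∧ Q (s.setRarr A (i.val s) (e.val s))
  | seq P P', Q, s => P.wp w (P'.wp w Q) s
  | ite c P P', Q, s => c.Fits w s ∧ (c.Holds s → P.wp w Q s) ∧ (¬ c.Holds s → P'.wp w Q s)
  | loop _ _, _, _ => False

/-- A bound for the running time of a program without loops. -/
@[simp] def stepBound : Prog → ℕ
  | skip => 1
  | assign _ e => e.time + 1
  | store _ i e => i.time + e.time + 1
  | rassign _ e => e.time + 1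
  | rstore _ i e => i.time + e.time + 1
  | seq P P' => P.stepBound + P'.stepBound
  | ite c P P' => c.time + max P.stepBound P'.stepBound
  | loop _ _ => 0

/-- Runs `P` with the register `x` taking the values from `e` up to, but not including, the content
of the register `y`. -/
def forRange (x : ℕ) (e : NExp) (y : ℕ) (P : Prog) : Prog :=
  assign x e ;; loop (.not (.le (.var y) (.var x))) (P ;; assign x (.add (.var x) (.lit 1)))

theorem wp_mono {w : ℕ} {P : Prog} {Q R : State → Prop} {s : State} (h : P.wp w Q s)
    (hQ : ∀ s', Q s' → R s') : P.wp w R s := by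
  induction P generalizing s Q R with
  | skip => exact hQ _ h
  | seq P P' ih ih' => exact ih h fun _ h' => ih' h' hQ
  | ite c P P' ih ih' => exact ⟨h.1, fun hc => ih (h.2.1 hc) hQ, fun hc => ih' (h.2.2 hc) hQ⟩
  | loop => exact h
  | _ => exact ⟨h.1, hQ _ h.2⟩

theorem wp_seq {w : ℕ} {P P' : Prog} {Q R : State → Prop} {s : State} (h : P.wp w Q s)
    (h' : ∀ s', Q s' → P'.wp w R s') : (P ;; P').wp w R s := by
  rw [wp]
  exact wp_mono h h'

end Prog

namespace Runs

variable {w t t₁ t₂ : ℕ} {P P' : Prog} {s : State} {Q R : State → Prop}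

theorem mono (h : Runs w P s t₁ Q) (ht : t₁ ≤ t) (hQ : ∀ s', Q s' → R s') : Runs w P s t R := by
  obtain ⟨t', s', he, ht', hs'⟩ := h
  exact ⟨t', s', he, ht'.trans ht, hQ s' hs'⟩

theorem seq (h : Runs w P s t₁ Q) (h' : ∀ s', Q s' → Runs w P' s' t₂ R) :
    Runs w (P ;; P') s (t₁ + t₂) R := by
  obtain ⟨a, s', he, ha, hs'⟩ := h
  obtain ⟨b, s'', he', hb, hs''⟩ := h' s' hs'
  exact ⟨_, s'', .seq _ _ _ _ _ _ _ he he', add_le_add ha hb, hs''⟩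

theorem of_wp_stepBound (h : P.wp w Q s) : Runs w P s P.stepBound Q := by
  induction P generalizing s Q with
  | skip => exact ⟨_, _, .skip s, le_rfl, h⟩
  | assign x e => exact ⟨_, _, .assign s x e h.1, le_rfl, h.2⟩
  | store A i e => exact ⟨_, _, .store s A i e h.1.1 h.1.2, le_rfl, h.2⟩
  | rassign x e => exact ⟨_, _, .rassign s x e h.1, le_rfl, h.2⟩
  | rstore A i e => exact ⟨_, _, .rstore s A i e h.1.1 h.1.2, le_rfl, h.2⟩
  | seq P P' ih ih' => exact (ih h).seq fun s' hs' => ih' hs'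
  | ite c P P' ih ih' =>
    obtain ⟨hc, hpos, hneg⟩ := h
    by_cases hh : c.Holds s
    · obtain ⟨t, s', he, ht, hs'⟩ := ih (hpos hh)
      exact ⟨_, s', .ite_pos _ _ _ _ _ _ hc hh he,
        Nat.add_le_add_left (ht.trans (le_max_left _ _)) _, hs'⟩
    · obtain ⟨t, s', he, ht, hs'⟩ := ih' (hneg hh)
      exact ⟨_, s', .ite_neg _ _ _ _ _ _ hc hh he,
        Nat.add_le_add_left (ht.trans (le_max_right _ _)) _, hs'⟩
  | loop => exact h.elim

theorem of_wp (h : P.wp w Q s) (ht : P.stepBound ≤ t) : Runs w P s t Q :=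
  (of_wp_stepBound h).mono ht fun _ => id

theorem loop {c : Test} (J : ℕ → State → Prop) {m : ℕ}
    (hfits : ∀ k s, J k s → c.Fits w s) (htest : ∀ k s, J k s → (c.Holds s ↔ k < m))
    (hbody : ∀ k s, k < m → J k s → Runs w P s t (J (k + 1)))
    {k : ℕ} (hk : k ≤ m) (hs : J k s) :
    Runs w (.loop c P) s ((m - k) * (t + c.time) + c.time) (J m) := by
  induction hd : m - k generalizing k s with
  | zero =>
    obtain rfl : k = m := by omega
    exact ⟨_, s, .loop_done _ _ _ (hfits k s hs) (by simp [htest k s hs]), by simp, hs⟩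
  | succ d ih =>
    have hkm : k < m := by omega
    obtain ⟨t₁, s₁, he₁, ht₁, hs₁⟩ := hbody k s hkm hs
    obtain ⟨t₂, s₂, he₂, ht₂, hs₂⟩ := ih hkm hs₁ (by omega)
    refine ⟨_, s₂, .loop_step _ _ _ _ _ _ _ (hfits k s hs) ((htest k s hs).2 hkm) he₁ he₂, ?_, hs₂⟩
    linarith [add_mul d 1 (t + c.time)]

theorem forRange {x y : ℕ} {e : NExp} (J : ℕ → State → Prop) {m N : ℕ} (he : e.Fits w s)
    (hx : ∀ k s, J k s → s.reg x = k) (hy : ∀ k s, J k s → s.reg y = m) (hmw : m ≤ w)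
    (hmN : m ≤ N + 1) (hem : e.val s ≤ m) (hs : J (e.val s) (s.setReg x (e.val s)))
    (hbody : ∀ k s, k < m → J k s →
      Runs w P s t fun s' => s'.reg x = k ∧ J (k + 1) (s'.setReg x (k + 1))) :
    Runs w (.forRange x e y P) s ((N + 1) * (t + e.time + 13)) (J m) := by
  have hpass : ∀ k s, k < m → J k s →
      Runs w (P ;; .assign x (.add (.var x) (.lit 1))) s (t + 4) (J (k + 1)) := by
    intro k s hk hJ
    refine (hbody k s hk hJ).seq fun s' ⟨hxk, hJ'⟩ => of_wp ?_ le_rfl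
    simp only [Prog.wp, NExp.Fits, NExp.val, hxk, true_and]
    exact ⟨by omega, hJ'⟩
  have hloop := loop (s := s.setReg x (e.val s)) (c := .not (.le (.var y) (.var x))) J
    (fun _ _ _ => ⟨trivial, trivial⟩)
    (fun k s hJ => by simp [hx k s hJ, hy k s hJ]) hpass hem hs
  have hinit := of_wp (P := .assign x e) (Q := (· = s.setReg x (e.val s))) ⟨he, rfl⟩ le_rfl
  refine (hinit.seq fun s' hs' => hs' ▸ hloop).mono ?_ fun _ => id
  have : (m - e.val s) * (t + 4 + 4) ≤ (N + 1) * (t + 8) :=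
    Nat.mul_le_mul (by omega) (by omega)
  simp only [Prog.stepBound, Test.time, NExp.time]
  nlinarith

end Runs

/-! ### The program -/

-- The word registers that the program uses.  The registers that stay fixed for longer come first.
namespace Reg

@[simp] abbrev size : ℕ := 0

@[simp] abbrev width : ℕ := 1

@[simp] abbrev stage : ℕ := 2

@[simp] abbrev last : ℕ := 3

@[simp] abbrev length : ℕ := 4

@[simp] abbrev left : ℕ := 5

@[simp] abbrev right : ℕ := 6

@[simp] abbrev cell : ℕ := 7

@[simp] abbrev split : ℕ := 8

@[simp] abbrev lo : ℕ := 9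

@[simp] abbrev hi : ℕ := 10

@[simp] abbrev probe : ℕ := 11

end Reg

/-- The cells with the record of the subproblem that has the keys added in the stages up to `st` and
the intervals `i, …, i + d`.  The cells up to `n` are left to the input and to the leaves of the
keys. -/
def recordIdx (n st d i : ℕ) : ℕ := ((st + 1) * (n + 1) + d) * (n + 1) + i

namespace Program

open Prog

/-- Evaluates `recordIdx`; the stage is followed by the length and the left end of the run. -/
def addr (st d i : NExp) : NExp :=
  .add (.mul (.add (.mul (.add st (.lit 1)) (.var Reg.width)) d) (.var Reg.width)) i

/-- Writes the record of the current subproblem.  Beside the word arrays of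
`State.Represents`, a record has the cost of its tree in real array `2` and the weight of its tree
in real array `3`. -/
def storeRecord (kind item yes no : NExp) (c w : RExp) : Prog :=
  store 0 (.var Reg.cell) kind ;; store 1 (.var Reg.cell) item ;;
  store 2 (.var Reg.cell) yes ;; store 3 (.var Reg.cell) no ;;
  rstore 2 (.var Reg.cell) c ;; rstore 3 (.var Reg.cell) w

/-- Records the leaf of the interval `left`. -/
def storeGapLeaf : Prog :=
  storeRecord (.lit 1) (.var Reg.left) (.lit 0) (.lit 0) .zero (.read 1 (.var Reg.left))

/-- Records the test for equality with the key that was added last, followed by the tree at `lo`. -/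
def storeEq : Prog :=
  storeRecord (.lit 2) (.var Reg.last) (.var Reg.last) (.var Reg.lo)
    (.add (.add (.read 0 (.var Reg.last)) (.read 3 (.var Reg.lo))) (.read 2 (.var Reg.lo)))
    (.add (.read 0 (.var Reg.last)) (.read 3 (.var Reg.lo)))

/-- Makes the current record a copy of the record at `lo`. -/
def copyRecord : Prog :=
  storeRecord (.read 0 (.var Reg.lo)) (.read 1 (.var Reg.lo)) (.read 2 (.var Reg.lo))
    (.read 3 (.var Reg.lo)) (.read 2 (.var Reg.lo)) (.read 3 (.var Reg.lo))

/-- Finds the records of the two subproblems that the less-than test with the key `split` leaves,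
and puts the cost of the resulting tree into real register `0`. -/
def evalSplit : Prog :=
  assign Reg.lo (addr (.var Reg.stage) (.sub (.var Reg.split) (.var Reg.left)) (.var Reg.left)) ;;
  assign Reg.hi (addr (.var Reg.stage)
    (.sub (.var Reg.right) (.add (.var Reg.split) (.lit 1))) (.add (.var Reg.split) (.lit 1))) ;;
  rassign 0 (.add (.add (.add (.read 3 (.var Reg.lo)) (.read 3 (.var Reg.hi)))
    (.read 2 (.var Reg.lo))) (.read 2 (.var Reg.hi)))

/-- Records the tree that `evalSplit` has found. -/
def storeSplit : Prog :=
  storeRecord (.lit 3) (.var Reg.split) (.var Reg.lo) (.var Reg.hi) (.var 0)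
    (.add (.read 3 (.var Reg.lo)) (.read 3 (.var Reg.hi)))

/-- Tries the less-than test with the key `split` at the root. -/
def trySplit : Prog :=
  evalSplit ;; ite (.rle (.read 2 (.var Reg.cell)) (.var 0)) skip storeSplit

/-- The first tree for a subproblem in the stage `0`, where no key has been added. -/
def initFirst : Prog :=
  ite (.eq (.var Reg.left) (.var Reg.right)) storeGapLeaf
    (assign Reg.split (.var Reg.left) ;; evalSplit ;; storeSplit)

/-- The first tree for a subproblem in a later stage.  It is derived from the tree for the same
run of intervals in the previous stage, whose record is `width * width` places further down. -/
def initHeavy : Prog :=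
  assign Reg.lo (.sub (.var Reg.cell) (.mul (.var Reg.width) (.var Reg.width))) ;;
  ite (.and (.le (.var Reg.left) (.add (.var Reg.last) (.lit 1)))
      (.le (.add (.var Reg.last) (.lit 1)) (.var Reg.right)))
    storeEq copyRecord

/-- Solves the subproblem with the intervals `left, …, right`. -/
def solveCell (init : Prog) : Prog :=
  assign Reg.cell (addr (.var Reg.stage) (.var Reg.length) (.var Reg.left)) ;; init ;;
  forRange Reg.split (.var Reg.left) Reg.right trySplit

/-- Solves all subproblems of a stage that have the same length. -/
def fillRow (init : Prog) : Prog :=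
  assign Reg.left (.lit 0) ;;
  forRange Reg.right (.var Reg.length) Reg.width
    (solveCell init ;; assign Reg.left (.add (.var Reg.left) (.lit 1)))

/-- Solves all subproblems of a stage. -/
def fillTable (init : Prog) : Prog :=
  forRange Reg.length (.lit 0) Reg.width (fillRow init)

/-- Replaces `last` by `probe` if this is a lighter key that has not been added yet; the value `n`
of `last` stands for no key, and word array `4` marks the keys that have been added. -/
def considerKey : Prog :=
  ite (.and (.eq (.read 4 (.var Reg.probe)) (.lit 0))
      (.not (.and (.not (.eq (.var Reg.last) (.var Reg.size)))
        (.rle (.read 0 (.var Reg.last)) (.read 0 (.var Reg.probe))))))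
    (assign Reg.last (.var Reg.probe)) skip

/-- Adds the lightest key that has not been added yet. -/
def addKey : Prog :=
  assign Reg.last (.var Reg.size) ;; forRange Reg.probe (.lit 0) Reg.size considerKey ;;
  store 4 (.var Reg.last) (.lit 1)

/-- Makes the cell `e` a record of the leaf of the key `e`, for every key. -/
def setup : Prog :=
  assign Reg.width (.add (.var Reg.size) (.lit 1)) ;;
  forRange Reg.probe (.lit 0) Reg.size (store 1 (.var Reg.probe) (.var Reg.probe))

/-- Puts the record and the cost of the tree for the whole instance into the registers `0`. -/
def output : Prog :=
  assign 0 (addr (.var Reg.size) (.var Reg.size) (.lit 0)) ;; rassign 0 (.read 2 (.var 0))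

/-- Computes an optimal tree for the instance in the input registers and arrays. -/
def main : Prog :=
  setup ;; fillTable initFirst ;;
  forRange Reg.stage (.lit 1) Reg.width (addKey ;; fillTable initHeavy) ;; output

end Program

/-! ### Records -/

namespace State

/-- The state in which a record has been written. -/
def setRecord (s : State) (p kind item yes no : ℕ) (c w : ℝ) : State :=
  s.setArr 0 p kind |>.setArr 1 p item |>.setArr 2 p yes |>.setArr 3 p no
    |>.setRarr 2 p c |>.setRarr 3 p w

/-- The states agree on the registers below `r` and on the array cells below `p`. -/
structure AgreesBelow (r p : ℕ) (s s' : State) : Prop where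
  reg : ∀ x < r, s'.reg x = s.reg x
  arr : ∀ B, ∀ k < p, s'.arr B k = s.arr B k
  rarr : ∀ B, ∀ k < p, s'.rarr B k = s.rarr B k

/-- The record at `p` represents the tree `T` whatever the cells above `p` contain. -/
def Stored (s : State) (p : ℕ) (T : Tree n) : Prop :=
  ∀ s' : State, (∀ B < 4, ∀ k ≤ p, s'.arr B k = s.arr B k) → s'.Represents p T

variable {s s' s'' : State} {r r' p p' x v kind item yes no : ℕ} {c w : ℝ} {T : Tree n}

namespace AgreesBelow

theorem refl (r p : ℕ) (s : State) : s.AgreesBelow r p s :=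
  ⟨fun _ _ => rfl, fun _ _ _ => rfl, fun _ _ _ => rfl⟩

theorem trans (h : s.AgreesBelow r p s') (h' : s'.AgreesBelow r' p' s'') (hr : r ≤ r')
    (hp : p ≤ p') : s.AgreesBelow r p s'' :=
  ⟨fun x hx => (h'.reg x (hx.trans_le hr)).trans (h.reg x hx),
    fun B k hk => (h'.arr B k (hk.trans_le hp)).trans (h.arr B k hk),
    fun B k hk => (h'.rarr B k (hk.trans_le hp)).trans (h.rarr B k hk)⟩

theorem mono (h : s.AgreesBelow r' p' s') (hr : r ≤ r') (hp : p ≤ p') : s.AgreesBelow r p s' :=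
  (refl r p s).trans h hr hp

theorem setReg (h : s.AgreesBelow r p s') (hx : r ≤ x) : s.AgreesBelow r p (s'.setReg x v) :=
  ⟨fun y hy => by simp [(hy.trans_le hx).ne, h.reg y hy], h.arr, h.rarr⟩

theorem setRreg (h : s.AgreesBelow r p s') (x : ℕ) (a : ℝ) : s.AgreesBelow r p (s'.setRreg x a) :=
  ⟨h.reg, h.arr, h.rarr⟩

theorem setRecord (h : s.AgreesBelow r p s') :
    s.AgreesBelow r p (s'.setRecord p kind item yes no c w) :=
  ⟨h.reg, fun B k hk => by simp [State.setRecord, hk.ne, h.arr B k hk],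
    fun B k hk => by simp [State.setRecord, hk.ne, h.rarr B k hk]⟩

end AgreesBelow

theorem Stored.represents (h : s.Stored p T) : s.Represents p T := h s fun _ _ _ _ => rfl

theorem Stored.congr (h : s.Stored p T) (hs : ∀ B < 4, ∀ k ≤ p, s'.arr B k = s.arr B k) :
    s'.Stored p T :=
  fun s'' hs'' => h s'' fun B hB k hk => (hs'' B hB k hk).trans (hs B hB k hk)

theorem Represents.copy (h : s.Represents p T) (hs : ∀ B < 4, s.arr B p' = s.arr B p) :
    s.Represents p' T := by
  rcases T with (e | a) | ⟨_ | _, b, Y, N⟩ <;>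
    simpa only [Represents, hs 0 (by simp), hs 1 (by simp), hs 2 (by simp), hs 3 (by simp)] using h

end State

/-- The type of a record whose tree begins with a comparison. -/
def Cmp.kind : Cmp → ℕ
  | .eq => 2
  | .lt => 3

/-- The record at `p` is a complete record of the tree `T`. -/
structure Inst.Records (I : Inst K n) (s : State) (p : ℕ) (T : Tree n) : Prop where
  stored : s.Stored p T
  cost : s.rarr 2 p = I.cost T
  wt : s.rarr 3 p = I.wt T

namespace Inst.Records

variable {I : Inst K n} {s s' : State} {p q : ℕ} {T : Tree n}

theorem congr (h : I.Records s p T) (harr : ∀ B < 4, s'.arr B = s.arr B)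
    (hrarr : s'.rarr = s.rarr) : I.Records s' p T :=
  ⟨h.stored.congr fun B hB _ _ => by rw [harr B hB], by rw [hrarr, h.cost], by rw [hrarr, h.wt]⟩

theorem of_agreesBelow {r : ℕ} (h : I.Records s p T) (hs : s.AgreesBelow r q s') (hp : p < q) :
    I.Records s' p T :=
  ⟨h.stored.congr fun B _ k hk => hs.arr B k (hk.trans_lt hp),
    (hs.rarr 2 p hp).trans h.cost, (hs.rarr 3 p hp).trans h.wt⟩

theorem setRecord_gap (a : Fin (n + 1)) :
    I.Records (s.setRecord p 1 a 0 0 0 (I.α a)) p (.leaf (.gap a)) where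
  stored := fun s' hs' => by simp [State.Represents, hs', State.setRecord]
  cost := by simp [State.setRecord]
  wt := by simp [State.setRecord, Inst.wt, weight]

theorem setRecord_node {Y N : Tree n} {yes no : ℕ} (c : Cmp) (b : Fin n) (hY : s.Stored yes Y)
    (hN : s.Stored no N) (hyes : yes < p) (hno : no < p) :
    I.Records (s.setRecord p c.kind b yes no (I.cost (.node c b Y N)) (I.wt (.node c b Y N))) p
      (.node c b Y N) where
  stored := fun s' hs' => by
    have hagree := (State.AgreesBelow.refl 0 p s).setRecord
      (kind := c.kind) (item := b) (yes := yes) (no := no) (c := I.cost (.node c b Y N))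
      (w := I.wt (.node c b Y N))
    have hY' : s'.Represents yes Y := hY s' fun B hB k hk =>
      (hs' B hB k (hk.trans hyes.le)).trans (hagree.arr B k (hk.trans_lt hyes))
    have hN' : s'.Represents no N := hN s' fun B hB k hk =>
      (hs' B hB k (hk.trans hno.le)).trans (hagree.arr B k (hk.trans_lt hno))
    cases c <;> simp [State.Represents, hs', State.setRecord, Cmp.kind, hY', hN']
  cost := by simp [State.setRecord]
  wt := by simp [State.setRecord]

theorem setRecord_copy (h : I.Records s q T) (hqp : q < p) :
    I.Records (s.setRecord p (s.arr 0 q) (s.arr 1 q) (s.arr 2 q) (s.arr 3 q) (s.rarr 2 q)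
      (s.rarr 3 q)) p T where
  stored := fun s' hs' => by
    have hagree : ∀ B < 4, ∀ k ≤ q, s'.arr B k = s.arr B k := fun B hB k hk =>
      (hs' B hB k (hk.trans hqp.le)).trans
        ((State.AgreesBelow.refl 0 p s).setRecord.arr B k (hk.trans_lt hqp))
    refine (h.stored s' hagree).copy fun B hB => ?_
    rw [hs' B hB p le_rfl, hagree B hB q le_rfl]
    interval_cases B <;> simp [State.setRecord]
  cost := by simp [State.setRecord, h.cost]
  wt := by simp [State.setRecord, h.wt]

end Inst.Records

/-! ### The table of records -/

section RecordIdx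

variable {st d d' i i' : ℕ}

theorem recordIdx_le (hst : st ≤ n) (hid : i + d ≤ n) : recordIdx n st d i ≤ 2 * (n + 1) ^ 3 := by
  have hmul : (st + 1) * (n + 1) + d ≤ (n + 1) * (n + 1) + d := by gcongr
  calc recordIdx n st d i ≤ ((n + 1) * (n + 1) + d) * (n + 1) + i := by
        unfold recordIdx; gcongr
    _ ≤ 2 * (n + 1) ^ 3 := by nlinarith [Nat.zero_le (n ^ 3)]

theorem recordIdx_lt_of_lex (hi' : i' ≤ n) (h : d' < d ∨ d' = d ∧ i' < i) :
    recordIdx n st d' i' < recordIdx n st d i := by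
  unfold recordIdx
  rcases h with h | ⟨rfl, h⟩
  · nlinarith
  · omega

theorem recordIdx_le_zero_left : recordIdx n st 0 0 ≤ recordIdx n st d i := by
  unfold recordIdx
  nlinarith

theorem recordIdx_succ_stage :
    recordIdx n (st + 1) d i = recordIdx n st d i + (n + 1) * (n + 1) := by
  unfold recordIdx
  ring

theorem recordIdx_succ_length : recordIdx n st (n + 1) 0 = recordIdx n (st + 1) 0 0 := by
  unfold recordIdx
  ring

theorem lt_recordIdx : n < recordIdx n st d i := by
  unfold recordIdx
  nlinarith [Nat.zero_le ((st * (n + 1) + d) * (n + 1))]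

theorem two_mul_add_one_le_of_cube_le {w : ℕ} (hw : 2 * (n + 1) ^ 3 ≤ w) : 2 * (n + 1) ≤ w :=
  (Nat.mul_le_mul_left 2 (Nat.le_self_pow three_ne_zero (n + 1))).trans hw

end RecordIdx

theorem Program.wp_assign_addr {w x st d i : ℕ} {s : State} {e f g : NExp} {Q : State → Prop}
    (hw : 2 * (n + 1) ^ 3 ≤ w) (hwidth : s.reg Reg.width = n + 1)
    (hfits : e.Fits w s ∧ f.Fits w s ∧ g.Fits w s) (he : e.val s = st) (hf : f.val s = d)
    (hg : g.val s = i) (hst : st ≤ n) (hid : i + d ≤ n)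
    (hQ : Q (s.setReg x (recordIdx n st d i))) : (Prog.assign x (addr e f g)).wp w Q s := by
  have hle := (recordIdx_le hst hid).trans hw
  have hval : (addr e f g).val s = recordIdx n st d i := by
    simp [addr, recordIdx, hwidth, he, hf, hg]
  refine ⟨?_, hval ▸ hQ⟩
  unfold recordIdx at hle
  set row := (st + 1) * (n + 1) + d with hrow
  have hrow_le : row ≤ row * (n + 1) := Nat.le_mul_of_pos_right _ n.succ_pos
  have hst_le : st + 1 ≤ (st + 1) * (n + 1) := Nat.le_mul_of_pos_right _ n.succ_pos
  simp only [addr, NExp.Fits, NExp.val, hwidth, hfits, he, hf, hg, true_and, ← hrow]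
  omega

namespace Inst

variable (I : Inst K n) (A : Finset (Fin n)) (st d i : ℕ)

/-- What holds from the end of `Program.setup` on: the cells below the table contain the weights
and the leaves of the keys. -/
structure Setup (s : State) : Prop where
  size : s.reg Reg.size = n
  width : s.reg Reg.width = n + 1
  keyWeight : ∀ e : Fin n, s.rarr 0 e = I.β e
  gapWeight : ∀ a : Fin (n + 1), s.rarr 1 a = I.α a
  keyLeaf : ∀ e : Fin n, s.Stored e (.leaf (.key e) : Tree n)

/-- The table is correct for the keys in `A` up to, but not including, the record of the run of
length `d` from `i` on. -/
def Filled (s : State) : Prop :=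
  ∀ d' i', i' + d' ≤ n → (d' < d ∨ d' = d ∧ i' < i) →
    ∃ T, I.OptimalFor (labels A i' (i' + d')) T ∧ I.Records s (recordIdx n st d' i') T

/-- The registers are set for the subproblem with the intervals `i, …, i + d`, and the smaller
subproblems have been solved. -/
structure AtCell (s : State) : Prop extends Setup I s where
  stage : s.reg Reg.stage = st
  length : s.reg Reg.length = d
  left : s.reg Reg.left = i
  right : s.reg Reg.right = i + d
  cell : s.reg Reg.cell = recordIdx n st d i
  stage_le : st ≤ n
  right_le : i + d ≤ n
  filled : Filled I A st d i s

/-- The current record is correct as far as the splits at keys of index below `k` are concerned. -/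
def Progress (k : ℕ) (s : State) : Prop :=
  ∃ T, I.OptimalUpToSplits (labels A i (i + d)) k T ∧ I.Records s (recordIdx n st d i) T

/-- The registers are set for the split at the key `b`. -/
structure SplitAt (b : Fin n) (L R : Tree n) (s : State) : Prop where
  split : s.reg Reg.split = b
  optimal_left : I.OptimalFor (labels A i b) L
  optimal_right : I.OptimalFor (labels A (b + 1) (i + d)) R
  records_left : I.Records s (s.reg Reg.lo) L
  records_right : I.Records s (s.reg Reg.hi) R
  lo_lt : s.reg Reg.lo < recordIdx n st d i
  hi_lt : s.reg Reg.hi < recordIdx n st d i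
  cost : s.rreg 0 = I.cost (.node .lt b L R)

variable {I A st d i} {w r p k : ℕ} {s s' : State} {b : Fin n} {L R : Tree n}

theorem Setup.of_agreesBelow (h : I.Setup s) (hs : s.AgreesBelow r p s') (hr : 2 ≤ r)
    (hp : n < p) : I.Setup s' where
  size := (hs.reg _ (pos_of_gt hr)).trans h.size
  width := (hs.reg _ hr).trans h.width
  keyWeight e := (hs.rarr _ _ (by omega)).trans (h.keyWeight e)
  gapWeight a := (hs.rarr _ _ (by omega)).trans (h.gapWeight a)
  keyLeaf e := (h.keyLeaf e).congr fun B _ k hk => hs.arr B k (by omega)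

theorem Setup.setMark (h : I.Setup s) (k v : ℕ) : I.Setup (s.setArr 4 k v) where
  size := h.size
  width := h.width
  keyWeight := h.keyWeight
  gapWeight := h.gapWeight
  keyLeaf e := (h.keyLeaf e).congr fun B hB _ _ => by simp [hB.ne]

theorem Filled.of_agreesBelow (h : I.Filled A st d i s)
    (hs : s.AgreesBelow r (recordIdx n st d i) s') : I.Filled A st d i s' :=
  fun d' i' hid hlex =>
    let ⟨T, hT, hrec⟩ := h d' i' hid hlex
    ⟨T, hT, hrec.of_agreesBelow hs (recordIdx_lt_of_lex (by omega) hlex)⟩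

theorem Filled.congr (h : I.Filled A st d i s) (harr : ∀ B < 4, s'.arr B = s.arr B)
    (hrarr : s'.rarr = s.rarr) : I.Filled A st d i s' :=
  fun d' i' hid hlex =>
    let ⟨T, hT, hrec⟩ := h d' i' hid hlex
    ⟨T, hT, hrec.congr harr hrarr⟩

theorem Progress.setReg (h : I.Progress A st d i k s) (x v : ℕ) :
    I.Progress A st d i k (s.setReg x v) :=
  let ⟨T, hT, hrec⟩ := h
  ⟨T, hT, hrec.congr (fun _ _ => rfl) rfl⟩

theorem AtCell.of_agreesBelow (h : I.AtCell A st d i s)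
    (hs : s.AgreesBelow 8 (recordIdx n st d i) s') : I.AtCell A st d i s' where
  toSetup := h.toSetup.of_agreesBelow hs (by simp) lt_recordIdx
  stage := (hs.reg _ (by simp)).trans h.stage
  length := (hs.reg _ (by simp)).trans h.length
  left := (hs.reg _ (by simp)).trans h.left
  right := (hs.reg _ (by simp)).trans h.right
  cell := (hs.reg _ (by simp)).trans h.cell
  stage_le := h.stage_le
  right_le := h.right_le
  filled := h.filled.of_agreesBelow hs

/-! ### Solving one subproblem -/

theorem AtCell.wp_evalSplit (hs : I.AtCell A st d i s) (hw : 2 * (n + 1) ^ 3 ≤ w)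
    (hsplit : s.reg Reg.split = b) (hib : i ≤ b) (hbd : b < i + d) :
    Program.evalSplit.wp w (fun s' => s.AgreesBelow 9 (recordIdx n st d i + 1) s' ∧
      ∃ L R, I.SplitAt A st d i b L R s') s := by
  have hle := hs.right_le
  obtain ⟨L, hL, hLrec⟩ := hs.filled (b - i) i (by omega) (.inl (by omega))
  obtain ⟨R, hR, hRrec⟩ := hs.filled (i + d - (b + 1)) (b + 1) (by omega) (.inl (by omega))
  rw [Nat.add_sub_cancel' (by omega)] at hL hR
  have hlo : recordIdx n st (b - i) i < recordIdx n st d i :=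
    recordIdx_lt_of_lex (by omega) (.inl (by omega))
  have hhi : recordIdx n st (i + d - (b + 1)) (b + 1) < recordIdx n st d i :=
    recordIdx_lt_of_lex (by omega) (.inl (by omega))
  have hnw := two_mul_add_one_le_of_cube_le hw
  refine Program.wp_assign_addr (st := st) (d := b - i) (i := i) hw hs.width
    ⟨trivial, ⟨trivial, trivial⟩, trivial⟩ hs.stage (by simp [hsplit, hs.left]) hs.left
    hs.stage_le (by omega) ?_
  refine Program.wp_assign_addr (st := st) (d := i + d - (b + 1)) (i := b + 1) hw
    (by simp [hs.width]) ?_ (by simp [hs.stage]) (by simp [hs.right, hsplit]) (by simp [hsplit])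
    hs.stage_le (by omega) ?_
  · simp only [NExp.Fits, NExp.val, Reg.lo, Reg.split, State.reg_setReg, Nat.reduceEqDiff,
      ↓reduceIte, hsplit, Order.add_one_le_iff, true_and, and_self]
    omega
  have hagree := ((State.AgreesBelow.refl 9 (recordIdx n st d i + 1) s).setReg
    (x := Reg.lo) (v := recordIdx n st (b - i) i) (by simp)).setReg
    (x := Reg.hi) (v := recordIdx n st (i + d - (b + 1)) (b + 1)) (by simp)
  refine ⟨by simp, hagree.setRreg _ _, L, R, ?_⟩
  refine ⟨by simp [hsplit], hL, hR, ?_, ?_, by simpa using hlo, by simpa using hhi, ?_⟩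
  · simpa using hLrec.of_agreesBelow (hagree.setRreg 0 _) (by omega)
  · simpa using hRrec.of_agreesBelow (hagree.setRreg 0 _) (by omega)
  · simp [hLrec.wt, hLrec.cost, hRrec.wt, hRrec.cost, cost_node]

theorem Setup.wp_storeGapLeaf (h : I.Setup s) {a : Fin (n + 1)} (hleft : s.reg Reg.left = a)
    (hcell : s.reg Reg.cell = p) (hw : 1 ≤ w) :
    Program.storeGapLeaf.wp w (fun s' => s.AgreesBelow 9 p s' ∧
      I.Records s' p (.leaf (.gap a))) s := by
  have hrec := Records.setRecord_gap (I := I) (s := s) (p := p) a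
  rw [← h.gapWeight, ← hleft] at hrec
  simp only [Program.storeGapLeaf, Program.storeRecord, Prog.wp, NExp.Fits, NExp.val, RExp.Fits,
    RExp.val, hcell, hw, zero_le, true_and, State.reg_setArr, State.reg_setRarr]
  exact ⟨(State.AgreesBelow.refl _ _ s).setRecord, hrec⟩

theorem Setup.wp_storeEq (h : I.Setup s) {T : Tree n} (hlast : s.reg Reg.last = b)
    (hT : I.Records s (s.reg Reg.lo) T) (hnp : n < p) (hlo : s.reg Reg.lo < p)
    (hcell : s.reg Reg.cell = p) (hw : 2 ≤ w) :
    Program.storeEq.wp w (fun s' => s.AgreesBelow 9 p s' ∧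
      I.Records s' p (.node .eq b (.leaf (.key b)) T)) s := by
  have hrec := Records.setRecord_node (I := I) (p := p) .eq b (h.keyLeaf b) hT.stored (by omega) hlo
  simp only [cost_node, cost_leaf, add_zero, wt, weight] at hrec
  rw [← hT.cost, ← hT.wt, ← h.keyWeight, ← hlast] at hrec
  simp only [Program.storeEq, Program.storeRecord, Prog.wp, NExp.Fits, NExp.val, RExp.Fits,
    RExp.val, hcell, hw, true_and, State.reg_setArr, State.reg_setRarr]
  exact ⟨(State.AgreesBelow.refl _ _ s).setRecord, hrec⟩

theorem Records.wp_copyRecord {T : Tree n} (h : I.Records s (s.reg Reg.lo) T)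
    (hlo : s.reg Reg.lo < p) (hcell : s.reg Reg.cell = p) :
    Program.copyRecord.wp w (fun s' => s.AgreesBelow 9 p s' ∧ I.Records s' p T) s := by
  have hrec := h.setRecord_copy hlo
  simp only [Program.copyRecord, Program.storeRecord, Prog.wp, NExp.Fits, NExp.val, RExp.Fits,
    RExp.val, hcell, true_and, State.reg_setArr, State.reg_setRarr]
  exact ⟨(State.AgreesBelow.refl _ _ s).setRecord, hrec⟩

theorem SplitAt.wp_storeSplit (h : I.SplitAt A st d i b L R s)
    (hcell : s.reg Reg.cell = recordIdx n st d i) (hw : 3 ≤ w) :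
    Program.storeSplit.wp w (fun s' => s.AgreesBelow 9 (recordIdx n st d i) s' ∧
      I.Records s' (recordIdx n st d i) (.node .lt b L R)) s := by
  have hrec := Records.setRecord_node (I := I) (p := recordIdx n st d i) .lt b h.records_left.stored
    h.records_right.stored h.lo_lt h.hi_lt
  rw [← h.cost, wt, ← h.records_left.wt, ← h.records_right.wt, ← h.split] at hrec
  simp only [Program.storeSplit, Program.storeRecord, Prog.wp, NExp.Fits, NExp.val, RExp.Fits,
    RExp.val, hcell, hw, true_and, State.reg_setArr, State.reg_setRarr]
  exact ⟨(State.AgreesBelow.refl _ _ s).setRecord, hrec⟩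

theorem SplitAt.solves (h : I.SplitAt A st d i b L R s) (hib : i ≤ b) (hbd : b < i + d) :
    (Tree.node .lt b L R).Solves (labels A i (i + d)) :=
  solves_lt_labels_iff.2 ⟨hib, hbd, h.optimal_left.solves, h.optimal_right.solves⟩

theorem AtCell.wp_trySplit (hs : I.AtCell A st d i s) (hw : 2 * (n + 1) ^ 3 ≤ w)
    (hsplit : s.reg Reg.split = b) (hib : i ≤ b) (hbd : b < i + d)
    (hprog : I.Progress A st d i b s) :
    Program.trySplit.wp w (fun s' => s.AgreesBelow 9 (recordIdx n st d i) s' ∧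
      I.Progress A st d i (b + 1) s') s := by
  obtain ⟨T, hT, hrec⟩ := hprog
  refine Prog.wp_seq (hs.wp_evalSplit hw hsplit hib hbd) fun s' ⟨hagree, L, R, h⟩ => ?_
  have hrec' := hrec.of_agreesBelow hagree (Nat.lt_succ_self _)
  have hagree' := hagree.mono le_rfl (Nat.le_succ _)
  have hcell := (hs.of_agreesBelow (hagree'.mono (by simp) le_rfl)).cell
  have hL := labels_inter_accepted (A := A) (i := i) hbd ▸ h.optimal_left
  have hR := labels_diff_accepted (A := A) (j := i + d) hib ▸ h.optimal_right
  have hnw := two_mul_add_one_le_of_cube_le hw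
  have htest : (Test.rle (.read 2 (.var Reg.cell)) (.var 0)).Holds s' ↔
      I.cost T ≤ I.cost (.node .lt b L R) := by
    simp only [Test.Holds, RExp.val, NExp.val, hcell, hrec'.cost, h.cost]
  refine ⟨by simp, fun hle => ?_, fun hlt => ?_⟩
  · exact ⟨hagree', T, hT.succ hL hR hT.solves le_rfl (htest.1 hle), hrec'⟩
  · refine Prog.wp_mono (h.wp_storeSplit hcell (by omega)) fun s'' ⟨hagree'', hX⟩ => ?_
    have hcost := (not_le.1 (mt htest.2 hlt)).le
    exact ⟨hagree'.trans hagree'' le_rfl le_rfl, _,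
      hT.succ hL hR (h.solves hib hbd) hcost le_rfl, hX⟩

theorem AtCell.wp_initFirst (hs : I.AtCell ∅ st d i s) (hw : 2 * (n + 1) ^ 3 ≤ w) :
    Program.initFirst.wp w (fun s' => s.AgreesBelow 8 (recordIdx n st d i) s' ∧
      I.Progress ∅ st d i i s') s := by
  have hle := hs.right_le
  have hnw := two_mul_add_one_le_of_cube_le hw
  have htest : (Test.eq (.var Reg.left) (.var Reg.right)).Holds s ↔ d = 0 := by
    simp [hs.left, hs.right]
  refine ⟨⟨trivial, trivial⟩, fun h => ?_, fun h => ?_⟩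
  · obtain rfl := htest.1 h
    refine Prog.wp_mono (hs.wp_storeGapLeaf (a := ⟨i, by omega⟩) hs.left hs.cell (by omega))
      fun s' ⟨hagree, hrec⟩ => ⟨hagree.mono (by simp) le_rfl, _, ?_, hrec⟩
    have hlabels : labels ∅ i (i + 0) = {Label.gap (⟨i, by omega⟩ : Fin (n + 1))} :=
      labels_empty_self ⟨i, by omega⟩
    exact hlabels ▸ (optimalFor_singleton _).optimalUpToSplits i
  · have hd : 0 < d := Nat.pos_of_ne_zero (mt htest.2 h)
    have hin : i < n := by omega
    have hagree : s.AgreesBelow 8 (recordIdx n st d i) (s.setReg Reg.split i) :=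
      (State.AgreesBelow.refl _ _ s).setReg le_rfl
    have hs' := hs.of_agreesBelow hagree
    refine ⟨trivial, ?_⟩
    rw [NExp.val, hs.left]
    refine Prog.wp_seq (hs'.wp_evalSplit (b := ⟨i, hin⟩) hw (by simp) le_rfl (by simpa))
      fun s₁ ⟨hagree₁, L, R, h⟩ => ?_
    replace hagree := hagree.trans hagree₁ (by simp) (Nat.le_succ _)
    refine Prog.wp_mono (h.wp_storeSplit (hs.of_agreesBelow hagree).cell (by omega))
      fun s₂ ⟨hagree₂, hrec⟩ => ⟨hagree.trans hagree₂ (by simp) le_rfl, _, ?_, hrec⟩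
    have hopt := OptimalUpToSplits.of_no_keys (I := I) (h.solves le_rfl (by simpa)) (by simp)
      (labels_ne_singleton (by omega) hle)
    exact hopt.mono fun b L R hsolves => (solves_lt_labels_iff.1 hsolves).1

theorem AtCell.wp_initHeavy {h : Fin n} (hs : I.AtCell (insert h A) (st + 1) d i s)
    (hw : 2 * (n + 1) ^ 3 ≤ w) (hh : h ∉ A) (heavy : ∀ f ∈ A, I.β f ≤ I.β h)
    (hlast : s.reg Reg.last = h) (hA : I.Filled A st (n + 1) 0 s) :
    Program.initHeavy.wp w (fun s' => s.AgreesBelow 8 (recordIdx n (st + 1) d i) s' ∧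
      I.Progress (insert h A) (st + 1) d i i s') s := by
  have hle := hs.right_le
  have hnw := two_mul_add_one_le_of_cube_le hw
  obtain ⟨T, hT, hrec⟩ := hA d i hle (.inl (by omega))
  have hlo : recordIdx n st d i < recordIdx n (st + 1) d i := by
    rw [recordIdx_succ_stage]
    nlinarith
  have hsquare : (n + 1) * (n + 1) ≤ w := by
    have := (recordIdx_le hs.stage_le hle).trans hw
    rw [recordIdx_succ_stage] at this
    omega
  have hagree : s.AgreesBelow 8 (recordIdx n (st + 1) d i)
      (s.setReg Reg.lo (recordIdx n st d i)) := (State.AgreesBelow.refl _ _ s).setReg (by simp)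
  refine Prog.wp_seq (Q := (· = s.setReg Reg.lo (recordIdx n st d i)))
    (by simp [hs.width, hs.cell, recordIdx_succ_stage, hsquare]) ?_
  rintro s' rfl
  set s' := s.setReg Reg.lo (recordIdx n st d i) with hs'
  have hat := hs.of_agreesBelow hagree
  have hlast' : s'.reg Reg.last = h := (hagree.reg _ (by simp)).trans hlast
  have hlo' : s'.reg Reg.lo = recordIdx n st d i := by simp [hs']
  have hrec' := hlo' ▸ hrec.of_agreesBelow hagree hlo
  have htest : (Test.and (.le (.var Reg.left) (.add (.var Reg.last) (.lit 1)))
      (.le (.add (.var Reg.last) (.lit 1)) (.var Reg.right))).Holds s' ↔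
        i ≤ h + 1 ∧ h < i + d := by
    simp only [Test.Holds, NExp.val, hat.left, hat.right, hlast', Nat.succ_le_iff]
  refine ⟨?_, fun hmem => ?_, fun hmem => ?_⟩
  · simp only [Test.Fits, NExp.Fits, NExp.val, Reg.last, hlast', Order.add_one_le_iff, true_and,
      and_true, and_self]
    omega
  · exact Prog.wp_mono (hat.wp_storeEq hlast' hrec' lt_recordIdx (hlo'.trans_lt hlo) hat.cell
      (by omega)) fun s'' ⟨hagree', hrec''⟩ => ⟨hagree.trans hagree' (by simp) le_rfl, _,
        hT.optimalUpToSplits_insert hh heavy (htest.1 hmem), hrec''⟩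
  · rw [← labels_insert_of_notMem (mt htest.2 hmem)] at hT
    exact Prog.wp_mono (hrec'.wp_copyRecord (hlo'.trans_lt hlo) hat.cell)
      fun s'' ⟨hagree', hrec''⟩ =>
        ⟨hagree.trans hagree' (by simp) le_rfl, T, hT.optimalUpToSplits i, hrec''⟩

variable (I A st) in
/-- The program `init` finds a first tree for every subproblem of the stage `st`, in any state that
can arise in the stage when its table is filled from the state `s₀` on. -/
structure InitSpec (init : Prog) (w : ℕ) (s₀ : State) : Prop where
  stepBound_le : init.stepBound ≤ 71
  wp : ∀ d i s, s₀.AgreesBelow 4 (recordIdx n st 0 0) s → I.AtCell A st d i s →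
    init.wp w (fun s' => s.AgreesBelow 8 (recordIdx n st d i) s' ∧ I.Progress A st d i i s') s

variable {init : Prog} {s₀ : State}

theorem AtCell.tryAllSplits_runs (hs : I.AtCell A st d i s) (hw : 2 * (n + 1) ^ 3 ≤ w)
    (hprog : I.Progress A st d i i s) :
    Runs w (Prog.forRange Reg.split (.var Reg.left) Reg.right Program.trySplit) s
      ((n + 1) * 84) fun s' => s.AgreesBelow 8 (recordIdx n st d i) s' ∧
        I.Progress A st d i (i + d) s' := by
  have hle := hs.right_le
  have hnw := two_mul_add_one_le_of_cube_le hw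
  let J : ℕ → State → Prop := fun k s' => s'.reg Reg.split = k ∧ i ≤ k ∧
    s.AgreesBelow 8 (recordIdx n st d i) s' ∧ I.Progress A st d i k s'
  have hbody : ∀ k s', k < i + d → J k s' → Runs w Program.trySplit s' 70 fun s'' =>
      s''.reg Reg.split = k ∧ J (k + 1) (s''.setReg Reg.split (k + 1)) := by
    intro k s' hk ⟨hsplit, hik, hagree, hprog'⟩
    refine (Runs.of_wp ((hs.of_agreesBelow hagree).wp_trySplit (b := ⟨k, by omega⟩) hw hsplit hik
      hk hprog') (by decide)).mono le_rfl fun s'' ⟨hagree', hprog''⟩ => ?_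
    exact ⟨(hagree'.reg _ (by simp)).trans hsplit, by simp, by omega,
      (hagree.trans hagree' (by simp) le_rfl).setReg le_rfl, hprog''.setReg _ _⟩
  refine Runs.mono (Runs.forRange J trivial (fun k s' h => h.1)
    (fun k s' h => (hs.of_agreesBelow h.2.2.1).right) (m := i + d) (by omega) (by omega)
    (by simp [hs.left]) ?_ hbody) le_rfl fun s' h => h.2.2
  rw [NExp.val, hs.left]
  exact ⟨by simp, le_rfl, (State.AgreesBelow.refl _ _ s).setReg le_rfl, hprog.setReg _ _⟩

theorem InitSpec.solveCell_runs (hinit : I.InitSpec A st init w s₀)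
    (hs₀ : s₀.AgreesBelow 4 (recordIdx n st 0 0) s) (hw : 2 * (n + 1) ^ 3 ≤ w)
    (hs : I.AtCell A st d i (s.setReg Reg.cell (recordIdx n st d i))) :
    Runs w (Program.solveCell init) s ((n + 1) * 170) fun s' =>
      s.AgreesBelow 7 (recordIdx n st d i) s' ∧ I.Filled A st d (i + 1) s' := by
  set s₁ := s.setReg Reg.cell (recordIdx n st d i) with hs₁
  have hagree : s.AgreesBelow 7 (recordIdx n st d i) s₁ :=
    (State.AgreesBelow.refl _ _ s).setReg le_rfl
  have haddr : (Prog.assign Reg.cell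
      (Program.addr (.var Reg.stage) (.var Reg.length) (.var Reg.left))).wp w (· = s₁) s :=
    Program.wp_assign_addr hw (by simpa [hs₁] using hs.width) ⟨trivial, trivial, trivial⟩
      (by simpa [hs₁] using hs.stage) (by simpa [hs₁] using hs.length)
      (by simpa [hs₁] using hs.left) hs.stage_le hs.right_le rfl
  refine ((Runs.of_wp haddr (t := 12) (by decide)).seq (t₂ := 71 + (n + 1) * 84) ?_).mono
    (by omega) fun _ => id
  rintro _ rfl
  have hinit' := hinit.wp d i s₁ (hs₀.trans hagree (by simp) recordIdx_le_zero_left) hs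
  refine (Runs.of_wp hinit' hinit.stepBound_le).seq fun s₂ ⟨hagree₂, hprog⟩ => ?_
  refine ((hs.of_agreesBelow hagree₂).tryAllSplits_runs hw hprog).mono le_rfl
    fun s₃ ⟨hagree₃, T, hT, hrec⟩ => ?_
  have hagree₁₃ := hagree₂.trans hagree₃ le_rfl le_rfl
  refine ⟨hagree.trans hagree₁₃ (by simp) le_rfl, fun d' i' hid hlex => ?_⟩
  by_cases hnew : d' = d ∧ i' = i
  · obtain ⟨rfl, rfl⟩ := hnew
    exact ⟨T, hT.optimalFor fun b L R h => (solves_lt_labels_iff.1 h).2.1, hrec⟩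
  · exact hs.filled.of_agreesBelow hagree₁₃ d' i' hid (by omega)

/-! ### Filling the table -/

theorem Setup.atCell (h : I.Setup s) (hstage : s.reg Reg.stage = st)
    (hlength : s.reg Reg.length = d) (hleft : s.reg Reg.left = i)
    (hright : s.reg Reg.right = i + d) (hst : st ≤ n) (hid : i + d ≤ n)
    (hfilled : I.Filled A st d i s) :
    I.AtCell A st d i (s.setReg Reg.cell (recordIdx n st d i)) where
  toSetup := h.of_agreesBelow ((State.AgreesBelow.refl 2 (n + 1) s).setReg (by simp)) le_rfl
    n.lt_succ_self
  stage := by simpa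
  length := by simpa
  left := by simpa
  right := by simpa
  cell := by simp
  stage_le := hst
  right_le := hid
  filled := hfilled.congr (fun _ _ => rfl) rfl

theorem InitSpec.fillRow_runs (hinit : I.InitSpec A st init w s₀)
    (hs₀ : s₀.AgreesBelow 4 (recordIdx n st 0 0) s) (hw : 2 * (n + 1) ^ 3 ≤ w)
    (hsetup : I.Setup s) (hstage : s.reg Reg.stage = st) (hst : st ≤ n)
    (hlength : s.reg Reg.length = d) (hd : d ≤ n) (hfilled : I.Filled A st d 0 s) :
    Runs w (Program.fillRow init) s ((n + 1) * ((n + 1) * 190)) fun s' =>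
      s.AgreesBelow 5 (recordIdx n st 0 0) s' ∧ I.Filled A st (d + 1) 0 s' := by
  have hnw := two_mul_add_one_le_of_cube_le hw
  let J : ℕ → State → Prop := fun k s' => s'.reg Reg.right = k ∧
    s.AgreesBelow 5 (recordIdx n st 0 0) s' ∧
    ∃ i, s'.reg Reg.left = i ∧ i + d = k ∧ I.Filled A st d i s'
  have hbody : ∀ k s', k < n + 1 → J k s' →
      Runs w (Program.solveCell init ;;
        Prog.assign Reg.left (.add (.var Reg.left) (.lit 1))) s' ((n + 1) * 170 + 4) fun s'' =>
          s''.reg Reg.right = k ∧ J (k + 1) (s''.setReg Reg.right (k + 1)) := by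
    intro k s' hk ⟨hright, hagree, i, hleft, hik, hfilled'⟩
    have hat := (hsetup.of_agreesBelow hagree (by simp) lt_recordIdx).atCell
      ((hagree.reg _ (by simp)).trans hstage) ((hagree.reg _ (by simp)).trans hlength) hleft
      (hright.trans hik.symm) hst (by omega) hfilled'
    refine (hinit.solveCell_runs (hs₀.trans hagree (by simp) le_rfl) hw hat).seq
      fun s₁ ⟨hagree₁, hfilled₁⟩ => Runs.of_wp ?_ le_rfl
    have hleft₁ : s₁.reg Reg.left = i := (hagree₁.reg _ (by simp)).trans hleft
    have hright₁ : s₁.reg Reg.right = k := (hagree₁.reg _ (by simp)).trans hright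
    have hagree₂ := hagree.trans hagree₁ (by simp) recordIdx_le_zero_left
    simp only [Prog.wp, NExp.Fits, NExp.val, hleft₁, true_and]
    exact ⟨⟨by omega, by omega⟩, by simpa using hright₁, by simp,
      (hagree₂.setReg le_rfl).setReg (by simp), i + 1, by simp, by omega,
      hfilled₁.congr (fun _ _ => rfl) rfl⟩
  have hassign : (Prog.assign Reg.left (.lit 0)).wp w (· = s.setReg Reg.left 0) s := by simp
  have hloop : Runs w _ (s.setReg Reg.left 0) _ (J (n + 1)) :=
    Runs.forRange (e := .var Reg.length) J trivial (fun k s' h => h.1)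
      (fun k s' h => (hsetup.of_agreesBelow h.2.1 (by simp) lt_recordIdx).width)
      (N := n) (by omega) le_rfl (by simpa [hlength] using hd.trans n.le_succ)
      ⟨by simp, ((State.AgreesBelow.refl _ _ s).setReg le_rfl).setReg (by simp), 0, by simp,
        by simp [hlength], hfilled.congr (fun _ _ => rfl) rfl⟩ hbody
  refine ((Runs.of_wp hassign le_rfl).seq fun s' hs' => hs' ▸ hloop).mono ?_
    fun s' ⟨_, hagree, i, _, _, hfilled'⟩ => ⟨hagree, fun d' i' hid hlex =>
      hfilled' d' i' hid (by omega)⟩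
  simp only [Prog.stepBound, NExp.time]
  nlinarith

theorem InitSpec.fillTable_runs (hinit : I.InitSpec A st init w s) (hw : 2 * (n + 1) ^ 3 ≤ w)
    (hsetup : I.Setup s) (hstage : s.reg Reg.stage = st) (hst : st ≤ n) :
    Runs w (Program.fillTable init) s ((n + 1) * ((n + 1) * ((n + 1) * 210))) fun s' =>
      s.AgreesBelow 4 (recordIdx n st 0 0) s' ∧ I.Filled A st (n + 1) 0 s' := by
  have hnw := two_mul_add_one_le_of_cube_le hw
  let J : ℕ → State → Prop := fun k s' => s'.reg Reg.length = k ∧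
    s.AgreesBelow 4 (recordIdx n st 0 0) s' ∧ I.Filled A st k 0 s'
  have hbody : ∀ k s', k < n + 1 → J k s' →
      Runs w (Program.fillRow init) s' ((n + 1) * ((n + 1) * 190)) fun s'' =>
        s''.reg Reg.length = k ∧ J (k + 1) (s''.setReg Reg.length (k + 1)) := by
    intro k s' hk ⟨hlength, hagree, hfilled⟩
    refine (hinit.fillRow_runs hagree hw (hsetup.of_agreesBelow hagree (by simp) lt_recordIdx)
      ((hagree.reg _ (by simp)).trans hstage) hst hlength (by omega) hfilled).mono le_rfl
      fun s₁ ⟨hagree₁, hfilled₁⟩ => ⟨(hagree₁.reg _ (by simp)).trans hlength, by simp, ?_, ?_⟩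
    · exact (hagree.trans hagree₁ (by simp) le_rfl).setReg le_rfl
    · exact hfilled₁.congr (fun _ _ => rfl) rfl
  have hnone : I.Filled A st 0 0 (s.setReg Reg.length 0) := fun d' i' _ hlex => by omega
  refine Runs.mono (Runs.forRange J (Nat.zero_le w) (fun k s' h => h.1)
    (fun k s' h => (hsetup.of_agreesBelow h.2.1 (by simp) lt_recordIdx).width)
    (N := n) (by omega) le_rfl (by simp)
    ⟨by simp, (State.AgreesBelow.refl _ _ s).setReg le_rfl, hnone⟩ hbody) ?_ fun s' h => h.2
  simp only [NExp.time]
  nlinarith [Nat.zero_le (n * n)]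

/-! ### Adding a key -/

variable (I A) in
/-- `m` is the index of a lightest one of the keys outside `A` of index below `k`, or `n` if there
is no such key. -/
def LightestBelow (k m : ℕ) : Prop :=
  (m = n ∨ ∃ h ∉ A, m = h.val) ∧ ∀ g ∉ A, g.val < k → ∃ h : Fin n, m = h ∧ I.β h ≤ I.β g

namespace LightestBelow

variable {m : ℕ} {f : Fin n}

theorem take (hm : I.LightestBelow A f m) (hf : f ∉ A) (hle : ∀ h : Fin n, m = h → I.β f ≤ I.β h) :
    I.LightestBelow A (f + 1) f := by
  refine ⟨.inr ⟨f, hf, rfl⟩, fun g hg hgf => ⟨f, rfl, ?_⟩⟩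
  rcases Nat.lt_succ_iff_lt_or_eq.1 hgf with hgf | hgf
  · obtain ⟨h, hmh, hhg⟩ := hm.2 g hg hgf
    exact (hle h hmh).trans hhg
  · rw [Fin.ext hgf]

theorem keep (hm : I.LightestBelow A f m) (hle : f ∉ A → ∃ h : Fin n, m = h ∧ I.β h ≤ I.β f) :
    I.LightestBelow A (f + 1) m := by
  refine ⟨hm.1, fun g hg hgf => ?_⟩
  rcases Nat.lt_succ_iff_lt_or_eq.1 hgf with hgf | hgf
  · exact hm.2 g hg hgf
  · obtain rfl := Fin.ext hgf
    exact hle hg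

theorem exists_lightest (hm : I.LightestBelow A n m) (hA : A.card < n) :
    ∃ h ∉ A, m = h.val ∧ ∀ g ∉ A, I.β h ≤ I.β g := by
  obtain ⟨g, hg⟩ : ∃ g, g ∉ A := by
    by_contra! hall
    simp [Finset.eq_univ_iff_forall.2 hall] at hA
  rcases hm.1 with rfl | ⟨h, hh, rfl⟩
  · obtain ⟨h, hmh, -⟩ := hm.2 g hg g.isLt
    exact absurd hmh h.isLt.ne'
  · refine ⟨h, hh, rfl, fun g hg => ?_⟩
    obtain ⟨h', hh', hle⟩ := hm.2 g hg g.isLt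
    rwa [Fin.ext hh']

end LightestBelow

variable (I A st) in
/-- What holds at the end of the stage `st`, in which `A` has become the set of the keys added. -/
structure StageDone (s : State) : Prop extends Setup I s where
  marks : ∀ e : Fin n, s.arr 4 e = 0 ↔ e ∉ A
  card : A.card = st
  light : ∀ f ∈ A, ∀ g ∉ A, I.β f ≤ I.β g
  filled : I.Filled A st (n + 1) 0 s

theorem StageDone.of_agreesBelow (h : I.StageDone A st s)
    (hs : s.AgreesBelow 2 (recordIdx n (st + 1) 0 0) s') : I.StageDone A st s' where
  toSetup := h.toSetup.of_agreesBelow hs le_rfl lt_recordIdx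
  marks e := by rw [hs.arr 4 e (e.isLt.trans lt_recordIdx), h.marks]
  card := h.card
  light := h.light
  filled := h.filled.of_agreesBelow (recordIdx_succ_length (n := n) ▸ hs)

theorem StageDone.wp_considerKey {f : Fin n} (h : I.StageDone A st s)
    (hprobe : s.reg Reg.probe = f) (hlast : I.LightestBelow A f (s.reg Reg.last)) :
    Program.considerKey.wp w (fun s' => s.AgreesBelow 3 p s' ∧ s'.reg Reg.probe = f ∧
      I.LightestBelow A (f + 1) (s'.reg Reg.last)) s := by
  have hmarks := h.marks f
  have hweight := h.keyWeight f
  simp only [Program.considerKey, Prog.wp, Test.Fits, Test.Holds, NExp.Fits, NExp.val, RExp.Fits,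
    RExp.val, hprobe, h.size, hmarks, hweight, zero_le, true_and]
  refine ⟨fun hc => ⟨?_, by simpa using hprobe, ?_⟩, fun hc =>
    ⟨State.AgreesBelow.refl _ _ s, hlast.keep fun hf => ?_⟩⟩
  · exact (State.AgreesBelow.refl _ _ s).setReg le_rfl
  · refine State.reg_setReg s _ _ _ ▸ hlast.take hc.1 fun g hg => ?_
    rw [hg, h.keyWeight] at hc
    exact (not_le.1 fun hle => hc.2 ⟨g.isLt.ne, hle⟩).le
  · obtain ⟨hne, hle⟩ := not_not.1 fun hn => hc ⟨hf, hn⟩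
    obtain ⟨g, -, hg⟩ := hlast.1.resolve_left hne
    exact ⟨g, hg, by rwa [hg, h.keyWeight] at hle⟩

theorem StageDone.considerKeys_runs (h : I.StageDone A st s)
    (hlast : s.reg Reg.last = n) (hw : n + 1 ≤ w) :
    Runs w (Prog.forRange Reg.probe (.lit 0) Reg.size Program.considerKey) s ((n + 1) * 32)
      fun s' => s.AgreesBelow 3 (recordIdx n (st + 1) 0 0) s' ∧
        I.LightestBelow A n (s'.reg Reg.last) := by
  let J : ℕ → State → Prop := fun k s' => s'.reg Reg.probe = k ∧
    s.AgreesBelow 3 (recordIdx n (st + 1) 0 0) s' ∧ I.LightestBelow A k (s'.reg Reg.last)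
  have hdone : ∀ k s', J k s' → I.StageDone A st s' := fun k s' hJ =>
    h.of_agreesBelow (hJ.2.1.mono (by simp) le_rfl)
  have hbody : ∀ k s', k < n → J k s' → Runs w Program.considerKey s' 18 fun s'' =>
      s''.reg Reg.probe = k ∧ J (k + 1) (s''.setReg Reg.probe (k + 1)) := by
    intro k s' hk hJ
    refine Runs.mono (Runs.of_wp ((hdone k s' hJ).wp_considerKey (f := ⟨k, hk⟩)
      (p := recordIdx n (st + 1) 0 0) hJ.1 hJ.2.2)
      (by decide)) le_rfl fun s'' ⟨hagree, hprobe, hlast⟩ => ⟨hprobe, by simp, ?_, by simpa⟩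
    exact (hJ.2.1.trans hagree le_rfl le_rfl).setReg (by simp)
  have hnone : I.LightestBelow A 0 n := ⟨.inl rfl, by simp⟩
  exact Runs.mono (Runs.forRange J (Nat.zero_le w) (fun k s' hJ => hJ.1)
    (fun k s' hJ => (hdone k s' hJ).size) (N := n) (by omega) (by omega) (Nat.zero_le n)
    ⟨by simp, (State.AgreesBelow.refl _ _ s).setReg (by simp), by simpa [hlast] using hnone⟩ hbody)
    le_rfl fun s' hJ => hJ.2

theorem StageDone.addKey_runs (h : I.StageDone A st s) (hst : st < n) (hw : n + 1 ≤ w) :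
    Runs w Program.addKey s ((n + 1) * 40) fun s' => ∃ f ∉ A, s'.reg Reg.last = f ∧
      s'.reg Reg.stage = s.reg Reg.stage ∧ (∀ g ∉ A, I.β f ≤ I.β g) ∧
      (∀ e : Fin n, s'.arr 4 e = 0 ↔ e ∉ insert f A) ∧ I.Setup s' ∧
      I.Filled A st (n + 1) 0 s' := by
  have hassign : (Prog.assign Reg.last (.var Reg.size)).wp w (· = s.setReg Reg.last n) s := by
    simp [h.size]
  have hagree := (State.AgreesBelow.refl 3 (recordIdx n (st + 1) 0 0) s).setReg
    (x := Reg.last) (v := n) le_rfl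
  have hloop := (h.of_agreesBelow (hagree.mono (by simp) le_rfl)).considerKeys_runs (by simp) hw
  refine ((Runs.of_wp hassign le_rfl).seq (t₂ := (n + 1) * 32 + 3) ?_).mono ?_ fun _ => id
  · rintro _ rfl
    refine hloop.seq fun s₁ ⟨hagree₁, hlightest⟩ => Runs.of_wp ?_ le_rfl
    replace hagree := hagree.trans hagree₁ le_rfl le_rfl
    have hdone := h.of_agreesBelow (hagree.mono (by simp) le_rfl)
    obtain ⟨f, hf, hlast, hlight⟩ := hlightest.exists_lightest (h.card ▸ hst)
    refine ⟨⟨trivial, Nat.le_of_add_left_le hw⟩, f, hf, hlast, hagree.reg _ (by simp), hlight,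
      fun e => ?_, hdone.toSetup.setMark _ _, hdone.filled.congr (fun B hB => ?_) rfl⟩
    · by_cases hef : e = f
      · simp [hef, hlast]
      · simp [hlast, hef, ← Fin.ext_iff, hdone.marks]
    · funext k
      simp [hB.ne]
  · simp only [Prog.stepBound, NExp.time]
    omega

/-! ### The whole program -/

theorem StageDone.stage_runs (h : I.StageDone A st s) (hst : st < n)
    (hstage : s.reg Reg.stage = st + 1) (hw : 2 * (n + 1) ^ 3 ≤ w) :
    Runs w (Program.addKey ;; Program.fillTable Program.initHeavy) s ((n + 1) ^ 3 * 250) fun s' =>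
      s'.reg Reg.stage = st + 1 ∧ ∃ A', I.StageDone A' (st + 1) s' := by
  have hnw := two_mul_add_one_le_of_cube_le hw
  refine ((h.addKey_runs hst (by omega)).seq (t₂ := (n + 1) * ((n + 1) * ((n + 1) * 210)))
    ?_).mono ?_ fun _ => id
  · rintro s₁ ⟨f, hf, hlast, hstage₁, hlight, hmarks, hsetup, hfilled⟩
    rw [hstage] at hstage₁
    have hinit : I.InitSpec (insert f A) (st + 1) Program.initHeavy w s₁ :=
      ⟨by decide, fun d i s₂ hagree hat => hat.wp_initHeavy hw hf
        (fun e he => h.light e he f hf) ((hagree.reg _ (by simp)).trans hlast)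
        (hfilled.of_agreesBelow (recordIdx_succ_length (n := n) ▸ hagree))⟩
    refine (hinit.fillTable_runs hw hsetup hstage₁ hst).mono le_rfl fun s₂ ⟨hagree, hfilled₂⟩ =>
      ⟨(hagree.reg _ (by simp)).trans hstage₁, insert f A,
        hsetup.of_agreesBelow hagree (by simp) lt_recordIdx, fun e => ?_, ?_, ?_, hfilled₂⟩
    · rw [hagree.arr 4 e (e.isLt.trans lt_recordIdx), hmarks]
    · rw [Finset.card_insert_of_notMem hf, h.card]
    · intro e he g hg
      have hgA : g ∉ A := fun hgA => hg (Finset.mem_insert_of_mem hgA)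
      rcases Finset.mem_insert.1 he with rfl | he
      · exact hlight g hgA
      · exact h.light e he g hgA
  · nlinarith [Nat.zero_le (n ^ 3)]

theorem StageDone.stages_runs (h : I.StageDone A 0 s) (hw : 2 * (n + 1) ^ 3 ≤ w) :
    Runs w (Prog.forRange Reg.stage (.lit 1) Reg.width
      (Program.addKey ;; Program.fillTable Program.initHeavy)) s
      ((n + 1) * ((n + 1) ^ 3 * 250 + 14)) fun s' => ∃ A', I.StageDone A' n s' := by
  have hnw := two_mul_add_one_le_of_cube_le hw
  have hset : ∀ {A st s} v, I.StageDone A st s → I.StageDone A st (s.setReg Reg.stage v) :=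
    fun v hs => hs.of_agreesBelow ((State.AgreesBelow.refl _ _ _).setReg le_rfl)
  let J : ℕ → State → Prop := fun k s' => s'.reg Reg.stage = k ∧
    ∃ st A', k = st + 1 ∧ I.StageDone A' st s'
  have hbody : ∀ k s', k < n + 1 → J k s' →
      Runs w (Program.addKey ;; Program.fillTable Program.initHeavy) s' ((n + 1) ^ 3 * 250)
        fun s'' => s''.reg Reg.stage = k ∧ J (k + 1) (s''.setReg Reg.stage (k + 1)) := by
    rintro _ s' hk ⟨hstage, st, A', rfl, hs'⟩
    exact (hs'.stage_runs (by omega) hstage hw).mono le_rfl fun s'' ⟨hstage', A'', hs''⟩ =>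
      ⟨hstage', by simp, st + 1, A'', rfl, hset _ hs''⟩
  refine Runs.mono (Runs.forRange J (show 1 ≤ w by omega) (fun k s' hJ => hJ.1) (fun k s' hJ => ?_)
    (N := n) (by omega) le_rfl (Nat.succ_pos n) ⟨by simp, 0, A, rfl, hset _ h⟩ hbody) le_rfl ?_
  · obtain ⟨-, st, A', -, hs'⟩ := hJ
    exact hs'.width
  · rintro s' ⟨-, st, A', hst, hs'⟩
    obtain rfl := Nat.succ_injective hst
    exact ⟨A', hs'⟩

theorem setup_runs (I : Inst K n) (hw : n + 1 ≤ w) :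
    Runs w Program.setup I.input ((n + 1) * 21) fun s => s.reg Reg.stage = 0 ∧
      (∀ e : Fin n, s.arr 4 e = 0) ∧ I.Setup s := by
  let J : ℕ → State → Prop := fun k s => s.reg Reg.probe = k ∧ s.reg Reg.size = n ∧
    s.reg Reg.width = n + 1 ∧ s.reg Reg.stage = 0 ∧ s.rarr = I.input.rarr ∧
    (∀ i, s.arr 0 i = 0) ∧ (∀ i < k, s.arr 1 i = i) ∧ ∀ i, s.arr 4 i = 0
  have hassign : (Prog.assign Reg.width (.add (.var Reg.size) (.lit 1))).wp w
      (· = I.input.setReg Reg.width (n + 1)) I.input := by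
    simp only [Prog.wp, NExp.Fits, NExp.val, Inst.input, Order.lt_add_one_iff, Reg.size, ↓reduceIte,
      Order.add_one_le_iff, true_and, Reg.width, and_true]
    omega
  have hbody : ∀ k s, k < n → J k s →
      Runs w (Prog.store 1 (.var Reg.probe) (.var Reg.probe)) s 3 fun s' =>
        s'.reg Reg.probe = k ∧ J (k + 1) (s'.setReg Reg.probe (k + 1)) := by
    intro k s _ ⟨hprobe, hsize, hwidth, hstage, hrarr, hkind, hitem, hmarks⟩
    refine Runs.of_wp ⟨⟨trivial, trivial⟩, hprobe, ?_⟩ le_rfl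
    refine ⟨by simp, by simpa, by simpa, by simpa, hrarr, by simpa, fun i hi => ?_, by simpa⟩
    by_cases hik : i = k
    · simp [hik, hprobe]
    · simpa [hik, hprobe] using hitem i (by omega)
  have hloop : Runs w _ (I.input.setReg Reg.width (n + 1)) _ (J n) :=
    Runs.forRange (e := .lit 0) J (Nat.zero_le w) (fun k s h => h.1) (fun k s h => h.2.1)
      (N := n) (by omega) (by omega) (Nat.zero_le n) (by simp [J, Inst.input]) hbody
  refine ((Runs.of_wp hassign le_rfl).seq fun s' hs' => hs' ▸ hloop).mono ?_
    fun s ⟨_, hsize, hwidth, hstage, hrarr, hkind, hitem, hmarks⟩ =>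
      ⟨hstage, fun e => hmarks e, hsize, hwidth, fun e => ?_, fun a => ?_, fun e s' hs' => ?_⟩
  · simp only [Prog.stepBound, NExp.time]
    omega
  · simp [hrarr, Inst.input]
  · rw [hrarr]
    exact dif_pos a.isLt
  · simp [State.Represents, hs', hkind, hitem]

theorem StageDone.wp_output (h : I.StageDone A n s) (hw : 2 * (n + 1) ^ 3 ≤ w) :
    Program.output.wp w (fun s' => ∃ T, I.IsOptimal T ∧ s'.Represents (s'.reg 0) T ∧
      s'.rreg 0 = I.cost T) s := by
  obtain ⟨T, hT, hrec⟩ := h.filled n 0 (by omega) (.inl n.lt_succ_self)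
  obtain rfl : A = Finset.univ := by
    rw [← Finset.card_eq_iff_eq_univ, h.card, Fintype.card_fin]
  rw [zero_add, labels_univ, optimalFor_univ_iff] at hT
  refine Program.wp_assign_addr (d := n) (i := 0) hw h.width ⟨trivial, trivial, Nat.zero_le w⟩
    h.size h.size rfl le_rfl (by omega) ⟨trivial, T, hT, ?_, by simp [hrec.cost]⟩
  simpa using (hrec.congr (s' := (s.setReg 0 _).setRreg 0 _) (fun _ _ => rfl) rfl).stored.represents

theorem main_runs (I : Inst K n) (hw : 2 * (n + 1) ^ 3 ≤ w) :
    Runs w Program.main I.input (600 * (n + 1) ^ 4) fun s => ∃ T, I.IsOptimal T ∧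
      s.Represents (s.reg 0) T ∧ s.rreg 0 = I.cost T := by
  have hnw := two_mul_add_one_le_of_cube_le hw
  refine ((I.setup_runs (by omega)).seq (t₂ := (n + 1) * ((n + 1) * ((n + 1) * 210)) +
    ((n + 1) * ((n + 1) ^ 3 * 250 + 14) + 15)) ?_).mono ?_ fun _ => id
  · intro s₁ ⟨hstage, hmarks, hsetup⟩
    have hinit : I.InitSpec ∅ 0 Program.initFirst w s₁ :=
      ⟨by decide, fun d i s _ hat => hat.wp_initFirst hw⟩
    refine (hinit.fillTable_runs hw hsetup hstage (Nat.zero_le n)).seq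
      fun s₂ ⟨hagree, hfilled⟩ => ?_
    have hdone : I.StageDone ∅ 0 s₂ :=
      ⟨hsetup.of_agreesBelow hagree (by simp) lt_recordIdx,
        fun e => by simp [hagree.arr 4 e (e.isLt.trans lt_recordIdx), hmarks], rfl, by simp,
        hfilled⟩
    exact (hdone.stages_runs hw).seq fun s₃ ⟨A, hdone'⟩ =>
      Runs.of_wp (hdone'.wp_output hw) (by decide)
  · have hcube : (n + 1) * 1 ≤ (n + 1) * (n + 1) ^ 3 := by gcongr; exact Nat.one_le_pow' 3 n
    nlinarith

end Inst

theorem add_one_pow_four_le (n : ℕ) : (n + 1) ^ 4 ≤ 16 * (n ^ 4 + 1) := by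
  rcases Nat.eq_zero_or_pos n with rfl | hn
  · simp
  · calc (n + 1) ^ 4 ≤ (2 * n) ^ 4 := by gcongr; omega
      _ ≤ 16 * (n ^ 4 + 1) := by ring_nf; omega

end TwoWay

end

theorem corollary1 :
    ∃ (P : TwoWay.Prog) (C D : ℕ),
      ∀ (K : Type*) [LinearOrder K] (n : ℕ) (I : TwoWay.Inst K n),
        ∃ (t : ℕ) (s : TwoWay.State) (T : TwoWay.Tree n),
          TwoWay.Exec (C * (n + 1) ^ D) P I.input t s ∧
          t ≤ C * (n ^ 4 + 1) ∧
          I.IsOptimal T ∧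
          s.Represents (s.reg 0) T ∧
          s.rreg 0 = I.cost T := by
  refine ⟨TwoWay.Program.main, 9600, 3, fun K _ n I => ?_⟩
  obtain ⟨t, s, hexec, ht, T, hT⟩ := I.main_runs (w := 9600 * (n + 1) ^ 3)
    (Nat.mul_le_mul_right _ (by norm_num))
  refine ⟨t, s, T, hexec, ht.trans ?_, hT⟩
  calc 600 * (n + 1) ^ 4 ≤ 600 * (16 * (n ^ 4 + 1)) :=
        Nat.mul_le_mul_left 600 (TwoWay.add_one_pow_four_le n)
    _ = 9600 * (n ^ 4 + 1) := by ring
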